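/- Let $n\ge 1$, $d=2n-1$, and let $\mathbb S^d(\mathbb C)=\{z\in\mathbb C^n:|z|=1\}$ carry the round metric and the rotation-invariant probability measure $\nu$; write $L_p=L_p(\mathbb S^d(\mathbb C),\nu)$ for the space of complex-valued functions with its usual norm $\|\cdot\|_p$. Let $\Delta$ be the (nonnegative) Laplace–Beltrami operator, and for $k\ge 0$ let $\mathrm H_k=\{u\in C^\infty(\mathbb S^d(\mathbb C)):\Delta u=\theta_k u\}$ be its eigenspace for the eigenvalue $\theta_k=k(k+d-1)$. For $N\ge 1$ put $\mathcal T_N=\mathrm{lin}\{\mathrm H_k\}_{k=1}^N$ and $\mathcal T_N^0=\mathrm{lin}\{\mathrm H_k\}_{k=0}^N=\mathrm H_0\oplus\mathcal T_N$, where $\mathrm H_0$ is the space of constants. For a linear space $\mathcal T$ of functions put $E(f,\mathcal T,L_p)=\inf_{t\in\mathcal T}\|f-t\|_p$. For $\gamma>0$ and $f\in L_p$, a function $f^{(\gamma)}\in L_p$ is called the $\gamma$-th fractional derivative of $f$ if $\int f^{(\gamma)}\,d\nu=0$ and $$\int f^{(\gamma)}\,\overline{Y}\,d\nu=\theta_k^{\gamma/2}\int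 f\,\overline{Y}\,d\nu\qquad\text{for all }k\ge1,\ Y\in \mathrm H_k .$$ **Theorem.** Let $\gamma>(d-1)/2$. There is a constant $C>0$, depending only on $d$ and $\gamma$, such that for all $1\le p\le\infty$, all $f\in L_p$ that have a fractional derivative $f^{(\gamma)}\in L_p$, and all integers $N\ge1$: 1. if $\int f\,d\nu=0$, then $$E(f,\mathcal T_N,L_p)\le C\,N^{-\gamma}\,E(f^{(\gamma)},\mathcal T_N,L_p);$$ 2. without any condition on the mean of $f$, $$E(f,\mathcal T_N^0,L_p)\le C\,N^{-\gamma}\,E(f^{(\gamma)},\mathcal T_N^0,L_p).$$ -/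

import Mathlib

open MeasureTheory Metric
open scoped ENNReal ContDiff Laplacian

namespace ComplexSphere

noncomputable section

/-- The unit sphere of `ℂⁿ` (Hermitian norm). Its real dimension is `d = 2n - 1`. -/
abbrev CSphere (n : ℕ) : Type := sphere (0 : EuclideanSpace ℂ (Fin n)) 1

/-- The real dimension `d = 2n - 1` of the sphere of `ℂⁿ` (used for `n ≥ 1` only). -/
def realDim (n : ℕ) : ℕ := 2 * n - 1

/-- The rotation invariant surface measure, normalized to total mass one. -/
def nu (n : ℕ) : Measure (CSphere n) :=
  ((volume : Measure (EuclideanSpace ℂ (Fin n))).toSphere Set.univ)⁻¹ •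
    (volume : Measure (EuclideanSpace ℂ (Fin n))).toSphere

open Classical in
/-- The extension of `u` to `ℂⁿ \ {0}` that is constant on rays, `y ↦ u (y / ‖y‖)`
(with value `0` at the origin). -/
def radialExt {n : ℕ} (u : CSphere n → ℂ) (y : EuclideanSpace ℂ (Fin n)) : ℂ :=
  if h : (‖y‖⁻¹ : ℝ) • y ∈ sphere (0 : EuclideanSpace ℂ (Fin n)) 1 then u ⟨(‖y‖⁻¹ : ℝ) • y, h⟩
  else 0

/-- `u` is a smooth function on the sphere: its radially constant extension is smooth
off the origin. -/
def IsSmooth {n : ℕ} (u : CSphere n → ℂ) : Prop :=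
  ContDiffOn ℝ ∞ (radialExt u) {0}ᶜ

/-- The (nonnegative) Laplace-Beltrami operator of the round unit sphere: minus the Euclidean
Laplacian on `ℂⁿ = ℝ²ⁿ` of the radially constant extension, restricted to the sphere. -/
def laplaceBeltrami {n : ℕ} (u : CSphere n → ℂ) (x : CSphere n) : ℂ :=
  -(Δ (radialExt u)) (x : EuclideanSpace ℂ (Fin n))

/-- The eigenvalue `θ_k = k (k + d - 1)`. -/
def theta (n k : ℕ) : ℝ := k * (k + (realDim n : ℝ) - 1)

theorem radialExt_add {n : ℕ} (u v : CSphere n → ℂ) :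
    radialExt (u + v) = radialExt u + radialExt v := by
  funext y
  by_cases h : (‖y‖⁻¹ : ℝ) • y ∈ sphere (0 : EuclideanSpace ℂ (Fin n)) 1
  · simp only [radialExt, dif_pos h, Pi.add_apply]
  · simp only [radialExt, dif_neg h, Pi.add_apply, add_zero]

theorem radialExt_smul {n : ℕ} (c : ℂ) (u : CSphere n → ℂ) :
    radialExt (c • u) = c • radialExt u := by
  funext y
  by_cases h : (‖y‖⁻¹ : ℝ) • y ∈ sphere (0 : EuclideanSpace ℂ (Fin n)) 1
  · simp only [radialExt, dif_pos h, Pi.smul_apply]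
  · simp only [radialExt, dif_neg h, Pi.smul_apply, smul_zero]

theorem IsSmooth.contDiffAt {n : ℕ} {u : CSphere n → ℂ} (hu : IsSmooth u) (x : CSphere n) :
    ContDiffAt ℝ 2 (radialExt u) (x : EuclideanSpace ℂ (Fin n)) := by
  have hx : (x : EuclideanSpace ℂ (Fin n)) ≠ 0 := by
    intro h
    have := x.2
    simp [h] at this
  have h := ContDiffOn.contDiffAt hu (isOpen_compl_singleton.mem_nhds hx)
  exact h.of_le (WithTop.coe_le_coe.2 (le_top : (2 : ℕ∞) ≤ ⊤))

/-- The eigenspace `H_k` of the Laplace-Beltrami operator for the eigenvalue `θ_k`. -/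
def eigenspace (n k : ℕ) : Submodule ℂ (CSphere n → ℂ) where
  carrier := {u | IsSmooth u ∧ ∀ x, laplaceBeltrami u x = (theta n k : ℂ) * u x}
  zero_mem' := by
    have h0 : radialExt (0 : CSphere n → ℂ) = fun _ => 0 := by
      funext y
      simp [radialExt]
    refine ⟨?_, fun x => ?_⟩
    · simp only [IsSmooth, h0]
      exact contDiffOn_const
    · have : radialExt (0 : CSphere n → ℂ) = (0 : ℝ) • radialExt (0 : CSphere n → ℂ) := by
        rw [h0]; funext y; simp
      simp only [laplaceBeltrami, Pi.zero_apply, mul_zero, neg_eq_zero]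
      rw [this, InnerProductSpace.laplacian_smul]
      · simp
      · rw [h0]; exact contDiffAt_const
  add_mem' := by
    rintro u v ⟨hu, hu'⟩ ⟨hv, hv'⟩
    refine ⟨?_, fun x => ?_⟩
    · simp only [IsSmooth, radialExt_add]
      exact ContDiffOn.add hu hv
    · have h1 := hu' x
      have h2 := hv' x
      simp only [laplaceBeltrami] at h1 h2 ⊢
      rw [radialExt_add, (hu.contDiffAt x).laplacian_add (hv.contDiffAt x)]
      simp only [Pi.add_apply]
      rw [mul_add, ← h1, ← h2]
      ring
  smul_mem' := by
    rintro c u ⟨hu, hu'⟩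
    refine ⟨?_, fun x => ?_⟩
    · simp only [IsSmooth, radialExt_smul]
      exact ContDiffOn.const_smul c hu
    · have h1 := hu' x
      simp only [laplaceBeltrami] at h1 ⊢
      have h2 : c • radialExt u = ⇑(c • ContinuousLinearMap.id ℝ ℂ) ∘ radialExt u := by
        funext y; simp
      rw [radialExt_smul, h2, (hu.contDiffAt x).laplacian_CLM_comp_left]
      simp only [Function.comp_apply, _root_.smul_apply, ContinuousLinearMap.id_apply,
        Pi.smul_apply, smul_eq_mul]
      rw [mul_left_comm, ← h1]
      ring

/-- The linear span of the eigenspaces `H_k`, `k ∈ K`. -/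
def harmonicSpan (n : ℕ) (K : Finset ℕ) : Submodule ℂ (CSphere n → ℂ) :=
  ⨆ k ∈ K, eigenspace n k

/-- `T_N = lin {H_1, …, H_N}`. -/
def polySpace (n N : ℕ) : Submodule ℂ (CSphere n → ℂ) := harmonicSpan n (Finset.Icc 1 N)

/-- `H_0 + T_N = lin {H_0, H_1, …, H_N}`. -/
def polySpaceConst (n N : ℕ) : Submodule ℂ (CSphere n → ℂ) := harmonicSpan n (Finset.Icc 0 N)

/-- The best approximation `E(f, T, L_p) = inf {‖f - t‖_p : t ∈ T}`. -/
def bestApprox {n : ℕ} (f : CSphere n → ℂ) (T : Submodule ℂ (CSphere n → ℂ)) (p : ℝ≥0∞) : ℝ≥0∞ :=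
  ⨅ t ∈ T, eLpNorm (f - t) p (nu n)

/-- The Fourier coefficient `∫ f · conj Y dν` of `f` with respect to `Y`. -/
def fourierCoeff {n : ℕ} (f Y : CSphere n → ℂ) : ℂ :=
  ∫ x, f x * (starRingEnd ℂ) (Y x) ∂(nu n)

/-- `g` is a `γ`-th fractional derivative of `f`: the formal Fourier series of `g` is
`∑_{k ≥ 1} θ_k^{γ/2} ∑_m c_{k,m}(f) Y_m^k`. The coefficients are compared against every element
of each eigenspace, which is the same as comparing them on an orthonormal basis of it. -/
def IsFracDeriv {n : ℕ} (γ : ℝ) (f g : CSphere n → ℂ) : Prop :=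
  (∀ Y ∈ eigenspace n 0, fourierCoeff g Y = 0) ∧
  ∀ k : ℕ, 1 ≤ k → ∀ Y ∈ eigenspace n k,
    fourierCoeff g Y = ((theta n k ^ (γ / 2) : ℝ) : ℂ) * fourierCoeff f Y

end

end ComplexSphere

/-! Write d = 2n - 1, let Z_j be the reproducing kernel of H_j, and let K_M = ∑_{j ≤ M} C(d+M-j, d)
Z_j be the unnormalized Cesàro kernel of order d. The fractional derivative is inverted on high
degrees by a positive series of such kernels.

The kernels K_M are nonnegative (`eval_cesaro_nonneg`), so convolution with K_M has norm at most its
mass C(d+M, d) on all L_p at once (`eLpNorm_zonalConv_cesaro_le`). On the other hand j ↦ θ_j^{-γ/2},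
j ≥ 1, is completely monotone with limit 0, hence θ_j^{-γ/2} = ∑_{M ≥ j} C(d+M-j, d) a_M with a_M ≥
0 (`exists_cesaro_weights`). Therefore the operator ∑_{M > N} a_M K_M multiplies H_j by θ_j^{-γ/2}
for every j > N, and its norm is at most ∑_{M > N} C(d+M, d) a_M = O(N^{-γ}).

For t in the approximating space let F be the image of f^{(γ)} - t (`exists_cesaro_series`). Above
degree N the components of F are those of f, so f - F agrees almost everywhere with a polynomial q
of degree at most N (`ae_eq_sum_zonalConv`), and ‖f - q‖_p = ‖F‖_p = O(N^{-γ}) ‖f^{(γ)} - t‖_p. The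
infimum over t gives both claims.

The harmonic analysis needed is built from the Poisson kernel: its coefficients are eigenfunctions
by the Gegenbauer equation, Green's formula gives orthogonality, and a Korovkin argument for the
positive kernels K_M gives the reproducing property and completeness. -/

namespace ComplexSphere

/-! ### Zonal polynomials and positivity of the Cesàro kernels. -/

section Zonal

open Polynomial

/-- The polynomial `1 - 2 r t + r²` as a power series in `r` over `ℝ[t]`. -/
noncomputable def quadSeries : PowerSeries ℝ[X] :=
  1 - PowerSeries.C (2 * X) * PowerSeries.X + PowerSeries.X ^ 2

/-- The inverse of `1 - 2 r t + r²` as a power series in `r` over `ℝ[t]`. -/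
noncomputable def quadInv : PowerSeries ℝ[X] := PowerSeries.invOfUnit quadSeries 1

/-- The Poisson kernel `(1 - r²) / (1 - 2 r t + r²) ^ n` as a power series in `r` over `ℝ[t]`. -/
noncomputable def poissonSeries (n : ℕ) : PowerSeries ℝ[X] := (1 - PowerSeries.X ^ 2) * quadInv ^ n

/-- The zonal harmonic of degree `j` in real dimension `2 n`. -/
noncomputable def zonal (n j : ℕ) : ℝ[X] := PowerSeries.coeff j (poissonSeries n)

theorem quadSeries_mul_quadInv : quadSeries * quadInv = 1 :=
  PowerSeries.mul_invOfUnit _ _ (by simp [quadSeries])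

/-- The coefficientwise derivative of a power series over `ℝ[t]`. -/
noncomputable def coeffDerivative (f : PowerSeries ℝ[X]) : PowerSeries ℝ[X] :=
  PowerSeries.mk fun j => derivative (PowerSeries.coeff j f)

theorem coeffDerivative_mul (f g : PowerSeries ℝ[X]) :
    coeffDerivative (f * g) = coeffDerivative f * g + f * coeffDerivative g := by
  ext1 j
  simp [coeffDerivative, PowerSeries.coeff_mul, derivative_mul,
    Finset.sum_add_distrib]

theorem coeffDerivative_quadSeries : coeffDerivative quadSeries = -2 * PowerSeries.X := by
  ext1 j
  have h2 : (-2 * PowerSeries.X : PowerSeries ℝ[X]) = PowerSeries.C (-2) * PowerSeries.X := by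
    rw [map_neg, map_ofNat]
  rw [h2]
  simp only [coeffDerivative, quadSeries, PowerSeries.coeff_mk, map_add, map_sub,
    PowerSeries.coeff_C_mul, PowerSeries.coeff_one, PowerSeries.coeff_X, PowerSeries.coeff_X_pow]
  have h3 : derivative (2 * X : ℝ[X]) = 2 := by
    simp [derivative_mul]
  split_ifs <;> simp [h3]

theorem coeffDerivative_one_sub_sq :
    coeffDerivative (1 - PowerSeries.X ^ 2) = 0 := by
  ext1 j
  simp only [coeffDerivative, PowerSeries.coeff_mk, map_sub, PowerSeries.coeff_one,
    PowerSeries.coeff_X_pow]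
  split_ifs <;> simp

theorem coeffDerivative_quadInv :
    coeffDerivative quadInv = 2 * PowerSeries.X * quadInv ^ 2 := by
  have h : coeffDerivative (quadSeries * quadInv) = 0 := by
    rw [quadSeries_mul_quadInv]
    ext1 j
    simp only [coeffDerivative, PowerSeries.coeff_mk, PowerSeries.coeff_one]
    split_ifs <;> simp
  rw [coeffDerivative_mul, coeffDerivative_quadSeries] at h
  linear_combination quadInv * h - coeffDerivative quadInv * quadSeries_mul_quadInv

theorem coeffDerivative_quadInv_pow (n : ℕ) :
    coeffDerivative (quadInv ^ n) = 2 * (n : PowerSeries ℝ[X]) * PowerSeries.X * quadInv ^ (n + 1) := by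
  induction n with
  | zero =>
    ext1 j
    simp only [coeffDerivative, PowerSeries.coeff_mk, pow_zero, PowerSeries.coeff_one]
    split_ifs <;> simp
  | succ n ih =>
    rw [pow_succ, coeffDerivative_mul, ih, coeffDerivative_quadInv]
    push_cast
    ring

/-- Differentiating (1 - r²)(1 - 2rt + r²)^{-n} in t produces the factor 2nr and raises the exponent
by one. This links real dimension 2n to 2n + 2 and allows induction on n. -/
theorem derivative_zonal (n j : ℕ) :
    derivative (zonal n (j + 1)) = 2 * (n : ℝ[X]) * zonal (n + 1) j := by
  have h : coeffDerivative (poissonSeries n) =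
      PowerSeries.C (2 * (n : ℝ[X])) * (poissonSeries (n + 1) * PowerSeries.X) := by
    rw [poissonSeries, coeffDerivative_mul, coeffDerivative_one_sub_sq, coeffDerivative_quadInv_pow,
      poissonSeries]
    simp only [map_mul, map_natCast, map_ofNat]
    ring
  have h' := congrArg (PowerSeries.coeff (j + 1)) h
  rwa [PowerSeries.coeff_C_mul, PowerSeries.coeff_succ_mul_X, coeffDerivative,
    PowerSeries.coeff_mk] at h'

/-- The classical Poisson kernel of the circle; it reduces the lowest case of the Gegenbauer
equation to Chebyshev's equation. -/
theorem poissonSeries_one :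
    poissonSeries 1 = PowerSeries.mk fun j => if j = 0 then 1 else 2 * Chebyshev.T ℝ j := by
  have h : quadSeries * PowerSeries.mk
      (fun j : ℕ => if j = 0 then 1 else 2 * Chebyshev.T ℝ j) = 1 - PowerSeries.X ^ 2 := by
    ext1 j
    have hexp : quadSeries * PowerSeries.mk
        (fun j : ℕ => if j = 0 then 1 else 2 * Chebyshev.T ℝ j) =
        PowerSeries.mk (fun j : ℕ => if j = 0 then 1 else 2 * Chebyshev.T ℝ j)
        - PowerSeries.C (2 * X) * (PowerSeries.mk
          (fun j : ℕ => if j = 0 then 1 else 2 * Chebyshev.T ℝ j) * PowerSeries.X)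
        + PowerSeries.mk (fun j : ℕ => if j = 0 then 1 else 2 * Chebyshev.T ℝ j)
          * PowerSeries.X * PowerSeries.X := by
      rw [quadSeries]; ring
    rw [hexp]
    match j with
    | 0 => simp
    | 1 =>
      simp only [map_add, map_sub, PowerSeries.coeff_succ_mul_X, PowerSeries.coeff_C_mul,
        PowerSeries.coeff_mk, PowerSeries.coeff_one, PowerSeries.coeff_X_pow,
        PowerSeries.coeff_zero_mul_X]
      simp
    | 2 =>
      have := Chebyshev.T_add_two ℝ 0
      simp only [zero_add, Chebyshev.T_zero, Chebyshev.T_one] at this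
      simp only [map_add, map_sub, PowerSeries.coeff_succ_mul_X, PowerSeries.coeff_C_mul,
        PowerSeries.coeff_mk, PowerSeries.coeff_one, PowerSeries.coeff_X_pow]
      simp [this]
      ring
    | j + 3 =>
      have := Chebyshev.T_add_two ℝ (j + 1)
      simp only [map_add, map_sub, PowerSeries.coeff_succ_mul_X, PowerSeries.coeff_C_mul,
        PowerSeries.coeff_mk, PowerSeries.coeff_one, PowerSeries.coeff_X_pow]
      simp only [show j + 3 ≠ 0 by omega, show j + 2 ≠ 0 by omega, show j + 1 ≠ 0 by omega,
        show j + 3 ≠ 2 by omega, if_false]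
      push_cast
      rw [show (j : ℤ) + 3 = j + 1 + 2 by ring, this, show (j : ℤ) + 2 = j + 1 + 1 by ring]
      ring
  rw [poissonSeries, pow_one, ← h]
  linear_combination PowerSeries.mk
    (fun j : ℕ => if j = 0 then (1 : ℝ[X]) else 2 * Chebyshev.T ℝ j) * quadSeries_mul_quadInv

/-- The Gegenbauer differential equation. -/
theorem zonal_ode (n j : ℕ) :
    (1 - X ^ 2) * derivative (derivative (zonal (n + 1) j)) -
      (2 * (n : ℝ[X]) + 1) * X * derivative (zonal (n + 1) j) +
      (j : ℝ[X]) * ((j : ℝ[X]) + 2 * (n : ℝ[X])) * zonal (n + 1) j = 0 := by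
  induction n generalizing j with
  | zero =>
    have h : zonal (0 + 1) j = if j = 0 then 1 else 2 * Chebyshev.T ℝ j := by
      rw [zonal, zero_add, poissonSeries_one, PowerSeries.coeff_mk]
    rw [h]
    split_ifs with hj
    · simp [hj]
    · have h1 := Chebyshev.one_sub_X_sq_mul_derivative_derivative_T_eq_poly_in_T (R := ℝ) j
      simp only [derivative_mul, derivative_ofNat, zero_mul, zero_add]
      simp only [Function.iterate_succ, Function.iterate_zero, Function.comp_apply, id_eq] at h1
      push_cast at h1 ⊢
      linear_combination 2 * h1
  | succ n ih =>
    -- Differentiating the equation of degree j + 1 gives 2(n + 1) times the equation of degree j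
    -- one step higher in n.
    have h1 := congrArg derivative (ih (j + 1))
    have hd := derivative_zonal (n + 1) j
    simp only [derivative_mul, derivative_add, derivative_sub, hd, derivative_natCast,
      derivative_one, derivative_X, derivative_ofNat, derivative_X_pow, derivative_zero] at h1
    have hn : ((n + 1 : ℕ) : ℝ[X]) ≠ 0 := by exact_mod_cast Nat.succ_ne_zero n
    have h2 : (2 * ((n + 1 : ℕ) : ℝ[X])) ≠ 0 := mul_ne_zero two_ne_zero hn
    apply mul_left_cancel₀ h2
    simp only [Nat.cast_ofNat, C_ofNat] at h1
    push_cast at h1 ⊢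
    linear_combination h1

theorem zonal_zero (n : ℕ) : zonal n 0 = 1 := by
  have h := congrArg (PowerSeries.constantCoeff) quadSeries_mul_quadInv
  simp [quadSeries] at h
  simp [zonal, poissonSeries, h]

theorem poissonSeries_eq_succ (n : ℕ) :
    poissonSeries n = poissonSeries (n + 1)
      - PowerSeries.C (2 * X) * (poissonSeries (n + 1) * PowerSeries.X)
      + poissonSeries (n + 1) * PowerSeries.X * PowerSeries.X := by
  simp only [poissonSeries]
  have := quadSeries_mul_quadInv
  rw [quadSeries] at this
  linear_combination -(1 - PowerSeries.X ^ 2) * quadInv ^ n * this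

theorem zonal_recurrence (n j : ℕ) :
    zonal (n + 1) (j + 2) = zonal n (j + 2) + 2 * X * zonal (n + 1) (j + 1) - zonal (n + 1) j := by
  have h' := congrArg (PowerSeries.coeff (j + 2)) (poissonSeries_eq_succ n)
  simp only [map_add, map_sub, PowerSeries.coeff_succ_mul_X, PowerSeries.coeff_C_mul] at h'
  simp only [zonal]
  linear_combination -h'

theorem zonal_one (n : ℕ) : zonal n 1 = 2 * (n : ℝ[X]) * X := by
  induction n with
  | zero => simp [zonal, poissonSeries, PowerSeries.coeff_one, PowerSeries.coeff_X_pow]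
  | succ n ih =>
    have h' := congrArg (PowerSeries.coeff (0 + 1)) (poissonSeries_eq_succ n)
    simp only [map_add, map_sub, PowerSeries.coeff_succ_mul_X, PowerSeries.coeff_C_mul,
      PowerSeries.coeff_zero_mul_X] at h'
    have h0 := zonal_zero (n + 1)
    simp only [zonal] at ih h0 ⊢
    rw [h0, zero_add] at h'
    push_cast
    linear_combination -h' + ih

theorem zonal_two (n : ℕ) :
    zonal n 2 = ((n : ℝ[X]) + 1) * (2 * (n : ℝ[X]) * X ^ 2 - 1) := by
  induction n with
  | zero => simp [zonal, poissonSeries, PowerSeries.coeff_one, PowerSeries.coeff_X_pow]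
  | succ n ih =>
    have h := zonal_recurrence n 0
    rw [zero_add, zero_add, ih, zonal_one, zonal_zero] at h
    rw [h]
    push_cast
    ring

/-- The unnormalized Cesàro kernel of order `2 n - 1` and degree `M`. -/
noncomputable def cesaro (n M : ℕ) : ℝ[X] :=
  ∑ j ∈ Finset.range (M + 1), ((2 * n - 1 + (M - j)).choose (2 * n - 1) : ℝ[X]) * zonal n j

/-- The coefficients of the Fejér series `(1 + r) / ((1 - r) (1 - 2 r t + r²))`. -/
noncomputable def fejerCoeff (t : ℝ) : ℕ → ℝ
  | 0 => 1
  | 1 => 2 * t + 2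
  | N + 2 => 2 * t * fejerCoeff t (N + 1) - fejerCoeff t N + 2

/-- Both sides obey the same recurrence. Since |T_{N+1}| ≤ 1 on [-1, 1], this closed form yields the
sign of the coefficients for t < 1. -/
theorem one_sub_mul_fejerCoeff (t : ℝ) (N : ℕ) :
    (1 - t) * fejerCoeff t N = 1 - (Chebyshev.T ℝ (N + 1)).eval t := by
  induction N using Nat.twoStepInduction with
  | zero => simp [fejerCoeff]
  | one =>
    have := Chebyshev.T_add_two ℝ 0
    simp only [zero_add] at this
    norm_num [fejerCoeff, this]
    ring
  | more N h0 h1 =>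
    have := Chebyshev.T_add_two ℝ (N + 1)
    push_cast at h0 h1 ⊢
    rw [show (N : ℤ) + 2 + 1 = N + 1 + 2 by ring, this]
    simp only [fejerCoeff, eval_sub, eval_mul, eval_ofNat, eval_X]
    linear_combination 2 * t * h1 - h0

theorem fejerCoeff_one (N : ℕ) : fejerCoeff 1 N = ((N : ℝ) + 1) ^ 2 := by
  induction N using Nat.twoStepInduction with
  | zero => simp [fejerCoeff]
  | one => norm_num [fejerCoeff]
  | more N h0 h1 =>
    simp only [fejerCoeff, h0, h1]
    push_cast
    ring

theorem fejerCoeff_nonneg {t : ℝ} (ht : |t| ≤ 1) (N : ℕ) : 0 ≤ fejerCoeff t N := by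
  rcases (abs_le.1 ht).2.eq_or_lt with rfl | h
  · rw [fejerCoeff_one]; positivity
  · have h1 := one_sub_mul_fejerCoeff t N
    have h2 := (abs_le.1 (Chebyshev.abs_eval_T_real_le_one (N + 1) ht)).2
    exact nonneg_of_mul_nonneg_right (by linarith) (sub_pos.2 h)

theorem coeff_mul_nonneg {f g : PowerSeries ℝ} (hf : ∀ j, 0 ≤ PowerSeries.coeff j f)
    (hg : ∀ j, 0 ≤ PowerSeries.coeff j g) (j : ℕ) : 0 ≤ PowerSeries.coeff j (f * g) := by
  rw [PowerSeries.coeff_mul]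
  exact Finset.sum_nonneg fun p _ => mul_nonneg (hf _) (hg _)

theorem coeff_pow_nonneg {f : PowerSeries ℝ} (hf : ∀ j, 0 ≤ PowerSeries.coeff j f) (m j : ℕ) :
    0 ≤ PowerSeries.coeff j (f ^ m) := by
  induction m generalizing j with
  | zero =>
    rw [pow_zero, PowerSeries.coeff_one]
    split_ifs <;> simp
  | succ m ih =>
    rw [pow_succ]
    exact coeff_mul_nonneg ih hf j

/-- The coefficients of (1 - r)^{-2n} are the Cesàro weights, so multiplying by this series performs
the summation. -/
theorem eval_cesaro_eq_coeff (n M : ℕ) (hn : 1 ≤ n) (t : ℝ) :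
    (cesaro n M).eval t = PowerSeries.coeff M
      (PowerSeries.map (evalRingHom t) (poissonSeries n) * PowerSeries.mk 1 ^ (2 * n)) := by
  obtain ⟨m, hm⟩ : ∃ m, 2 * n = m + 1 := ⟨2 * n - 1, by omega⟩
  rw [cesaro, hm, PowerSeries.mk_one_pow_eq_mk_choose_add, PowerSeries.coeff_mul,
    Finset.Nat.sum_antidiagonal_eq_sum_range_succ_mk, eval_finsetSum]
  refine Finset.sum_congr rfl fun p _ => ?_
  simp [zonal, mul_comm]

/-- The Cesàro kernels of order `2 n - 1` are nonnegative. -/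
theorem eval_cesaro_nonneg (n M : ℕ) (hn : 1 ≤ n) {t : ℝ} (ht : |t| ≤ 1) :
    0 ≤ (cesaro n M).eval t := by
  rw [eval_cesaro_eq_coeff n M hn]
  obtain ⟨m, rfl⟩ : ∃ m, n = m + 1 := ⟨n - 1, by omega⟩
  set G : PowerSeries ℝ := PowerSeries.mk 1 with hG
  have hG1 : G * (1 - PowerSeries.X) = 1 := PowerSeries.mk_one_mul_one_sub_eq_one ℝ
  set q : PowerSeries ℝ := PowerSeries.map (evalRingHom t) quadInv with hq
  have hq1 : (1 - PowerSeries.C (2 * t) * PowerSeries.X + PowerSeries.X ^ 2) * q = 1 := by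
    have := congrArg (PowerSeries.map (evalRingHom t)) quadSeries_mul_quadInv
    simpa [quadSeries] using this
  set F : PowerSeries ℝ := PowerSeries.mk (fejerCoeff t) with hF
  have hF1 : (1 - PowerSeries.C (2 * t) * PowerSeries.X + PowerSeries.X ^ 2) * F =
      (1 + PowerSeries.X) * G := by
    have e1 : (1 - PowerSeries.C (2 * t) * PowerSeries.X + PowerSeries.X ^ 2) * F =
      F - PowerSeries.C (2 * t) * (F * PowerSeries.X) + F * PowerSeries.X * PowerSeries.X := by ring
    have e2 : (1 + PowerSeries.X) * G = G + G * PowerSeries.X := by ring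
    rw [e1, e2]
    ext1 j
    match j with
    | 0 => simp [hF, hG, fejerCoeff]
    | 1 =>
      simp only [map_add, map_sub, PowerSeries.coeff_succ_mul_X, PowerSeries.coeff_C_mul,
        PowerSeries.coeff_zero_mul_X, hF, hG, PowerSeries.coeff_mk, fejerCoeff, Pi.one_apply]
      ring
    | j + 2 =>
      simp only [map_add, map_sub, PowerSeries.coeff_succ_mul_X, PowerSeries.coeff_C_mul,
        hF, hG, PowerSeries.coeff_mk, fejerCoeff, Pi.one_apply]
      ring
  have hF2 : F = (1 + PowerSeries.X) * G * q := by
    linear_combination q * hF1 - F * hq1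
  set H : PowerSeries ℝ := PowerSeries.mk fun j => if Even j then 1 else 0 with hH
  have hH1 : (1 + PowerSeries.X) * H = G := by
    have e : (1 + PowerSeries.X) * H = H + H * PowerSeries.X := by ring
    rw [e]
    ext1 j
    rcases j with _ | j
    · simp [hH, hG]
    · simp only [map_add, PowerSeries.coeff_succ_mul_X, hH, hG, PowerSeries.coeff_mk,
        Nat.even_add_one, Pi.one_apply]
      split_ifs <;> simp_all
  -- With G = 1/(1 - r), q = 1/(1 - 2rt + r²), H = 1/(1 - r²) and the Fejér series F = (1 + r)Gq,
  -- one has FH = qG². The generating function thus factors into series with nonnegative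
  -- coefficients.
  have key : PowerSeries.map (evalRingHom t) (poissonSeries (m + 1)) * G ^ (2 * (m + 1)) =
      F * (F * H) ^ m := by
    have e1 : F * H = q * G ^ 2 := by
      rw [hF2]
      linear_combination G * q * hH1
    have e2 : PowerSeries.map (evalRingHom t) (poissonSeries (m + 1)) =
        (1 - PowerSeries.X ^ 2) * q ^ (m + 1) := by
      simp [poissonSeries, hq]
    rw [e1, e2, hF2]
    linear_combination (1 + PowerSeries.X) * G * q * (q * G ^ 2) ^ m * hG1
  rw [key]
  have hFn : ∀ j, 0 ≤ PowerSeries.coeff j F := fun j => by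
    rw [hF, PowerSeries.coeff_mk]; exact fejerCoeff_nonneg ht j
  have hHn : ∀ j, 0 ≤ PowerSeries.coeff j H := fun j => by
    rw [hH, PowerSeries.coeff_mk]; split_ifs <;> simp
  exact coeff_mul_nonneg hFn (coeff_pow_nonneg (coeff_mul_nonneg hFn hHn) m) M

end Zonal

/-! ### Completely monotone sequences and the Cesàro weights. -/

section CompletelyMonotone

/-- The backward-oriented difference `h k - h (k + 1)`. -/
def diffOp : (ℕ → ℝ) →ₗ[ℝ] (ℕ → ℝ) where
  toFun h k := h k - h (k + 1)
  map_add' f g := by ext k; simp; ring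
  map_smul' c f := by ext k; simp; ring

/-- A completely monotone sequence: all iterated differences are nonnegative. -/
def IsCM (h : ℕ → ℝ) : Prop := ∀ i k, 0 ≤ (diffOp ^ i) h k

theorem diffOp_apply (h : ℕ → ℝ) (k : ℕ) : diffOp h k = h k - h (k + 1) := rfl

theorem diffOp_pow_succ (i : ℕ) (h : ℕ → ℝ) : (diffOp ^ (i + 1)) h = (diffOp ^ i) (diffOp h) := by
  rw [pow_succ, Module.End.mul_apply]

theorem diffOp_pow_shift (i : ℕ) (h : ℕ → ℝ) (k : ℕ) :
    (diffOp ^ i) (fun k => h (k + 1)) k = (diffOp ^ i) h (k + 1) := by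
  induction i generalizing h with
  | zero => simp
  | succ i ih =>
    rw [diffOp_pow_succ, diffOp_pow_succ, ← ih]
    rfl

theorem IsCM.diffOp {h : ℕ → ℝ} (hh : IsCM h) : IsCM (diffOp h) := fun i k => by
  rw [← diffOp_pow_succ]; exact hh _ _

theorem IsCM.shift {h : ℕ → ℝ} (hh : IsCM h) : IsCM (fun k => h (k + 1)) := fun i k => by
  rw [diffOp_pow_shift]; exact hh _ _

/-- Discrete Leibniz rule: the difference of a product is a sum of two products of completely
monotone sequences, so induction on the order applies. -/
theorem IsCM.mul {f g : ℕ → ℝ} (hf : IsCM f) (hg : IsCM g) : IsCM (f * g) := by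
  intro i
  induction i generalizing f g with
  | zero => intro k; simpa using mul_nonneg (hf 0 k) (hg 0 k)
  | succ i ih =>
    intro k
    have : ComplexSphere.diffOp (f * g) =
        ComplexSphere.diffOp f * g + (fun k => f (k + 1)) * ComplexSphere.diffOp g := by
      ext k
      simp only [diffOp_apply, Pi.mul_apply, Pi.add_apply]
      ring
    rw [diffOp_pow_succ, this, map_add]
    exact add_nonneg (ih hf.diffOp hg k) (ih hf.shift hg.diffOp k)

theorem integrableOn_rpow_mul_one_sub_exp_pow {a r : ℝ} (ha : 0 < a) (hr : 0 < r) (i : ℕ) :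
    IntegrableOn (fun t : ℝ => t ^ (a - 1) * Real.exp (-(r * t)) * (1 - Real.exp (-t)) ^ i)
      (Set.Ioi 0) := by
  have h0 : IntegrableOn (fun t : ℝ => t ^ (a - 1) * Real.exp (-(r * t))) (Set.Ioi 0) := by
    have := integrableOn_rpow_mul_exp_neg_mul_rpow (p := 1) (s := a - 1) (b := r)
      (by linarith) one_pos hr
    simpa using this
  refine h0.mul_bdd (c := 1) (by fun_prop) ?_
  filter_upwards [ae_restrict_mem measurableSet_Ioi] with t ht
  have h1 : Real.exp (-t) ≤ 1 := Real.exp_le_one_iff.2 (by simpa using (le_of_lt ht))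
  have h2 := Real.exp_pos (-t)
  rw [norm_pow, Real.norm_eq_abs, abs_of_nonneg (by linarith)]
  exact pow_le_one₀ (by linarith) (by linarith)

/-- In the Gamma integral for (k + c)^{-a}, each difference in k inserts a factor 1 - e^{-t} ≥ 0. -/
theorem diffOp_pow_rpow_neg {a c : ℝ} (ha : 0 < a) (hc : 0 < c) (i k : ℕ) :
    (diffOp ^ i) (fun k : ℕ => ((k : ℝ) + c) ^ (-a)) k * Real.Gamma a =
      ∫ t in Set.Ioi (0 : ℝ),
        t ^ (a - 1) * Real.exp (-(((k : ℝ) + c) * t)) * (1 - Real.exp (-t)) ^ i := by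
  induction i generalizing k with
  | zero =>
    have hk : 0 < (k : ℝ) + c := by positivity
    simp only [pow_zero, mul_one, Module.End.one_apply]
    rw [Real.integral_rpow_mul_exp_neg_mul_Ioi ha hk, one_div, Real.inv_rpow hk.le,
      Real.rpow_neg hk.le]
  | succ i ih =>
    have hk : 0 < (k : ℝ) + c := by positivity
    have hk' : 0 < ((k + 1 : ℕ) : ℝ) + c := by positivity
    rw [pow_succ', Module.End.mul_apply, diffOp_apply, sub_mul, ih, ih, ← integral_sub
      (integrableOn_rpow_mul_one_sub_exp_pow ha hk i)
      (integrableOn_rpow_mul_one_sub_exp_pow ha hk' i)]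
    refine integral_congr_ae (Filter.Eventually.of_forall fun t => ?_)
    have : Real.exp (-((((k + 1 : ℕ) : ℝ) + c) * t)) =
        Real.exp (-(((k : ℝ) + c) * t)) * Real.exp (-t) := by
      rw [← Real.exp_add]; congr 1; push_cast; ring
    simp only [this]
    ring

theorem isCM_rpow_neg {a c : ℝ} (ha : 0 < a) (hc : 0 < c) :
    IsCM (fun k : ℕ => ((k : ℝ) + c) ^ (-a)) := by
  intro i k
  have h := diffOp_pow_rpow_neg ha hc i k
  refine nonneg_of_mul_nonneg_left ?_ (Real.Gamma_pos_of_pos ha)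
  rw [h]
  refine setIntegral_nonneg measurableSet_Ioi fun t ht => ?_
  have h1 : Real.exp (-t) ≤ 1 := Real.exp_le_one_iff.2 (by simpa using (le_of_lt ht))
  have h2 : 0 ≤ 1 - Real.exp (-t) := by linarith
  have h3 : 0 < t := ht
  positivity

theorem tendsto_diffOp {h : ℕ → ℝ} (h0 : Filter.Tendsto h Filter.atTop (nhds 0)) :
    Filter.Tendsto (diffOp h) Filter.atTop (nhds 0) := by
  have := h0.sub ((Filter.tendsto_add_atTop_iff_nat 1).2 h0)
  rw [sub_zero] at this
  exact this

theorem hasSum_diffOp {h : ℕ → ℝ} (hh : IsCM h)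
    (h0 : Filter.Tendsto h Filter.atTop (nhds 0)) (k : ℕ) :
    HasSum (fun i : ℕ => diffOp h (k + i)) (h k) := by
  have hnn : ∀ i, 0 ≤ diffOp h (k + i) := fun i => by simpa using hh 1 (k + i)
  rw [hasSum_iff_tendsto_nat_of_nonneg hnn]
  have hs : ∀ N, ∑ i ∈ Finset.range N, diffOp h (k + i) = h k - h (k + N) := fun N =>
    Finset.sum_range_sub' (fun i => h (k + i)) N
  simp only [hs]
  have : Filter.Tendsto (fun N => h (k + N)) Filter.atTop (nhds 0) := by
    simpa only [add_comm] using (Filter.tendsto_add_atTop_iff_nat k).2 h0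
  simpa using tendsto_const_nhds.sub this

/-- Iterated telescoping: inserting the expansion of the first difference into the telescoping
series gives a nonnegative double series. Grouped by diagonals, its weights add up by the
hockey-stick identity. -/
theorem hasSum_choose_mul_diffOp {h : ℕ → ℝ} (hh : IsCM h)
    (h0 : Filter.Tendsto h Filter.atTop (nhds 0)) (m k : ℕ) :
    HasSum (fun i : ℕ => ((m + i).choose m : ℝ) * (diffOp ^ (m + 1)) h (k + i)) (h k) := by
  induction m generalizing h k with
  | zero =>
    simpa using hasSum_diffOp hh h0 k
  | succ m ih =>
    have h1 : ∀ k, HasSum (fun i : ℕ => ((m + i).choose m : ℝ) *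
        (diffOp ^ (m + 2)) h (k + i)) (diffOp h k) := fun k => by
      have := ih hh.diffOp (tendsto_diffOp h0) k
      simpa only [← diffOp_pow_succ] using this
    have h2 := hasSum_diffOp hh h0 k
    set F : ℕ × ℕ → ℝ := fun p =>
      ((m + p.2).choose m : ℝ) * (diffOp ^ (m + 2)) h (k + p.1 + p.2) with hF
    have hFs : Summable F := by
      rw [summable_prod_of_nonneg fun p => mul_nonneg (Nat.cast_nonneg _) (hh _ _)]
      refine ⟨fun j => (h1 (k + j)).summable, ?_⟩
      refine h2.summable.congr fun j => ?_
      exact ((h1 (k + j)).tsum_eq).symm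
    have hFh : HasSum F (h k) := by
      have := hFs.hasSum.prod_fiberwise (fun j => h1 (k + j))
      rw [← this.unique h2]
      exact hFs.hasSum
    have h3 : HasSum (fun l => ∑ p ∈ Finset.HasAntidiagonal.antidiagonal l, F p) (h k) := by
      have := (Finset.HasAntidiagonal.sigmaAntidiagonalEquivProd.hasSum_iff.2 hFh).sigma
        (fun l => hasSum_fintype _)
      convert this using 2 with l
      exact (Finset.sum_coe_sort _ F).symm
    convert h3 using 2 with l
    have h4 : ∀ p ∈ Finset.HasAntidiagonal.antidiagonal l,
        F p = ((m + p.2).choose m : ℝ) * (diffOp ^ (m + 2)) h (k + l) := fun p hp => by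
      simp only [hF, ← Finset.HasAntidiagonal.mem_antidiagonal.1 hp, add_assoc]
    rw [Finset.sum_congr rfl h4, ← Finset.sum_mul, add_right_comm,
      ← Finset.sum_antidiagonal_choose_add]
    rw [Nat.cast_sum]

theorem theta_eq (n k : ℕ) (hn : 1 ≤ n) : theta n k = k * (k + (2 * n - 2)) := by
  rw [theta, realDim, Nat.cast_sub (by omega)]
  push_cast
  ring

/-- Each of the d factors of the quotient of binomials is at most 2. This compares the masses of the
kernels with the weights of an expansion started at M. -/
theorem choose_add_le_two_pow_mul (d k M : ℕ) (hM : 2 * M ≤ k) :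
    (d + k).choose d ≤ 2 ^ d * (d + (k - M)).choose d := by
  induction d with
  | zero => simp
  | succ d ih =>
    have h1 := Nat.add_one_mul_choose_eq (d + k) d
    have h2 := Nat.add_one_mul_choose_eq (d + (k - M)) d
    have h3 : d + k + 1 ≤ 2 * (d + (k - M) + 1) := by omega
    have h4 : (d + 1 + k).choose (d + 1) * (d + 1) ≤
        2 ^ (d + 1) * (d + 1 + (k - M)).choose (d + 1) * (d + 1) := by
      rw [show d + 1 + k = d + k + 1 by ring, ← h1,
        show d + 1 + (k - M) = d + (k - M) + 1 by ring, mul_assoc, ← h2]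
      calc (d + k + 1) * (d + k).choose d
          ≤ (2 * (d + (k - M) + 1)) * (2 ^ d * (d + (k - M)).choose d) := Nat.mul_le_mul h3 ih
        _ = _ := by ring
    exact Nat.le_of_mul_le_mul_right h4 (Nat.succ_pos d)

/-- The weights are differences of order d + 1 of k ↦ θ_{k+1}^{-γ/2}; the index is shifted because
θ_0 = 0. The tail is dominated by the full expansion of θ_M^{-γ/2} at M about N/2. -/
theorem exists_cesaro_weights (n : ℕ) (hn : 1 ≤ n) {γ : ℝ} (hγ : 0 < γ) (d : ℕ) :
    ∃ a : ℕ → ℝ, (∀ k, 0 ≤ a k) ∧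
      (∀ j, 1 ≤ j → HasSum (fun i => ((d + i).choose d : ℝ) * a (j + i))
        (theta n j ^ (-(γ / 2)))) ∧
      ∀ N : ℕ, 1 ≤ N → Summable (fun i => ((d + (N + 1 + i)).choose d : ℝ) * a (N + 1 + i)) ∧
        ∑' i, ((d + (N + 1 + i)).choose d : ℝ) * a (N + 1 + i) ≤
          2 ^ d * 2 ^ γ * (N : ℝ) ^ (-γ) := by
  have hn1 : (1 : ℝ) ≤ n := by exact_mod_cast hn
  set h : ℕ → ℝ := fun k => theta n (k + 1) ^ (-(γ / 2)) with hdef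
  -- θ_{k+1} = (k + 1)(k + 2n - 1), so complete monotonicity follows from that of the two factors.
  have hmul : h = (fun k : ℕ => ((k : ℝ) + 1) ^ (-(γ / 2))) *
      (fun k : ℕ => ((k : ℝ) + (2 * n - 1)) ^ (-(γ / 2))) := by
    ext k
    simp only [hdef, Pi.mul_apply, theta_eq n _ hn]
    push_cast
    rw [show (k : ℝ) + 1 + (2 * n - 2) = k + (2 * n - 1) by ring, Real.mul_rpow (by positivity)
      (by have : (0 : ℝ) ≤ k := by positivity
          linarith)]
  have hcm : IsCM h := by
    rw [hmul]
    exact (isCM_rpow_neg (by positivity) one_pos).mul (isCM_rpow_neg (by positivity) (by linarith))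
  have hle : ∀ k, 1 ≤ k → theta n k ^ (-(γ / 2)) ≤ (k : ℝ) ^ (-γ) := fun k hk => by
    have hk' : (1 : ℝ) ≤ k := by exact_mod_cast hk
    have h1 : (k : ℝ) ^ 2 ≤ theta n k := by rw [theta_eq n k hn]; nlinarith
    calc theta n k ^ (-(γ / 2)) ≤ ((k : ℝ) ^ 2) ^ (-(γ / 2)) :=
          Real.rpow_le_rpow_of_nonpos (by positivity) h1 (by linarith)
      _ = (k : ℝ) ^ (-γ) := by
          rw [← Real.rpow_natCast, ← Real.rpow_mul (by positivity)]
          congr 1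
          push_cast
          ring
  have hlim : Filter.Tendsto h Filter.atTop (nhds 0) := by
    have h1 : Filter.Tendsto (fun k : ℕ => ((k + 1 : ℕ) : ℝ) ^ (-γ)) Filter.atTop (nhds 0) :=
      (tendsto_rpow_neg_atTop hγ).comp
        (tendsto_natCast_atTop_atTop.comp (Filter.tendsto_add_atTop_nat 1))
    exact squeeze_zero (fun k => by simpa using hcm 0 k) (fun k => hle (k + 1) (by omega)) h1
  have ha : ∀ j, 1 ≤ j → HasSum (fun i => ((d + i).choose d : ℝ) *
      (diffOp ^ (d + 1)) h (j + i - 1)) (theta n j ^ (-(γ / 2))) := by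
    intro j hj
    obtain ⟨k, rfl⟩ : ∃ k, j = k + 1 := ⟨j - 1, by omega⟩
    have := hasSum_choose_mul_diffOp hcm hlim d k
    convert this using 4 with i
    omega
  refine ⟨fun k => (diffOp ^ (d + 1)) h (k - 1), fun k => hcm _ _, ha, fun N hN => ?_⟩
  set a : ℕ → ℝ := fun k => (diffOp ^ (d + 1)) h (k - 1) with hadef
  have hann : ∀ k, 0 ≤ a k := fun k => hcm _ _
  -- The largest M with 2M ≤ N + 1: the binomial comparison holds for every term of the tail, while
  -- M ≥ N/2 keeps the order N^{-γ}.
  set M := (N + 1) / 2 with hM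
  have hM1 : 1 ≤ M := by omega
  set b : ℕ → ℝ := fun i => ((d + i).choose d : ℝ) * a (M + i) with hb
  have hbs : HasSum b (theta n M ^ (-(γ / 2))) := ha M hM1
  have hbn : ∀ i, 0 ≤ b i := fun i => mul_nonneg (Nat.cast_nonneg _) (hann _)
  have hinj : Function.Injective fun i : ℕ => i + (N + 1 - M) := add_left_injective _
  have hcomp : Summable fun i : ℕ => 2 ^ d * b (i + (N + 1 - M)) :=
    (hbs.summable.comp_injective hinj).mul_left _
  have hterm : ∀ i, ((d + (N + 1 + i)).choose d : ℝ) * a (N + 1 + i) ≤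
      2 ^ d * b (i + (N + 1 - M)) := fun i => by
    have h1 := choose_add_le_two_pow_mul d (N + 1 + i) M (by omega)
    have h2 : M + (i + (N + 1 - M)) = N + 1 + i := by omega
    have h3 : N + 1 + i - M = i + (N + 1 - M) := by omega
    simp only [hb, h2]
    rw [h3] at h1
    rw [← mul_assoc]
    exact mul_le_mul_of_nonneg_right (by exact_mod_cast h1) (hann _)
  have hnn : ∀ i, 0 ≤ ((d + (N + 1 + i)).choose d : ℝ) * a (N + 1 + i) := fun i =>
    mul_nonneg (Nat.cast_nonneg _) (hann _)
  have hsum := Summable.of_nonneg_of_le hnn hterm hcomp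
  refine ⟨hsum, ?_⟩
  calc ∑' i, ((d + (N + 1 + i)).choose d : ℝ) * a (N + 1 + i)
      ≤ ∑' i, 2 ^ d * b (i + (N + 1 - M)) := hsum.tsum_le_tsum hterm hcomp
    _ = 2 ^ d * ∑' i, b (i + (N + 1 - M)) := tsum_mul_left
    _ ≤ 2 ^ d * ∑' i, b i := by
        exact mul_le_mul_of_nonneg_left (tsum_comp_le_tsum_of_inj hbs.summable hbn hinj)
          (by positivity)
    _ = 2 ^ d * theta n M ^ (-(γ / 2)) := by rw [hbs.tsum_eq]
    _ ≤ 2 ^ d * (M : ℝ) ^ (-γ) := by gcongr; exact hle M hM1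
    _ ≤ 2 ^ d * ((N : ℝ) / 2) ^ (-γ) := by
        have h1 : (N : ℝ) / 2 ≤ M := by
          have : N ≤ 2 * M := by omega
          have : (N : ℝ) ≤ 2 * M := by exact_mod_cast this
          linarith
        have h2 : (0 : ℝ) < N := by exact_mod_cast hN
        gcongr 2 ^ d * ?_
        exact Real.rpow_le_rpow_of_nonpos (by positivity) h1 (by linarith)
    _ = 2 ^ d * 2 ^ γ * (N : ℝ) ^ (-γ) := by
        rw [Real.div_rpow (by positivity) (by norm_num), Real.rpow_neg (x := 2) (by norm_num)]
        field_simp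

end CompletelyMonotone

/-! ### Laplace–Beltrami operator on zonal functions. -/

section Geometry

variable {n : ℕ}

theorem coe_ne_zero (x : CSphere n) : (x : EuclideanSpace ℂ (Fin n)) ≠ 0 :=
  ne_zero_of_mem_unit_sphere x

theorem radialExt_of_ne_zero (u : CSphere n → ℂ) {y : EuclideanSpace ℂ (Fin n)} (hy : y ≠ 0) :
    radialExt u y = u ⟨(‖y‖⁻¹ : ℝ) • y, by
      rw [mem_sphere_zero_iff_norm, norm_smul, norm_inv, norm_norm,
        inv_mul_cancel₀ (norm_ne_zero_iff.2 hy)]⟩ := by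
  rw [radialExt, dif_pos]

theorem radialExt_coe (u : CSphere n → ℂ) (x : CSphere n) : radialExt u x = u x := by
  rw [radialExt_of_ne_zero u (coe_ne_zero x)]
  congr 1
  ext1
  simp

theorem radialExt_smul_of_pos (u : CSphere n → ℂ) {c : ℝ} (hc : 0 < c)
    (y : EuclideanSpace ℂ (Fin n)) : radialExt u (c • y) = radialExt u y := by
  have h : (‖c • y‖⁻¹ : ℝ) • c • y = (‖y‖⁻¹ : ℝ) • y := by
    rw [norm_smul, smul_smul, Real.norm_eq_abs, abs_of_pos hc, mul_inv, mul_right_comm,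
      inv_mul_cancel₀ hc.ne', one_mul]
  by_cases hy : y = 0
  · simp [hy]
  · rw [radialExt_of_ne_zero u hy, radialExt_of_ne_zero u (smul_ne_zero hc.ne' hy)]
    congr 1
    exact Subtype.ext h

/-- Reduces the pure second derivatives in the Laplacian to one-variable calculus on lines. -/
theorem iteratedFDeriv_two_eq_of_line {E F : Type*} [NormedAddCommGroup E] [NormedSpace ℝ E]
    [NormedAddCommGroup F] [NormedSpace ℝ F] {f : E → F} {y e : E} {g₁ : ℝ → F} {g₂ : F}
    (hf : ContDiffAt ℝ 2 f y)
    (h₁ : ∀ᶠ s in nhds (0 : ℝ), HasDerivAt (fun s : ℝ => f (y + s • e)) (g₁ s) s)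
    (h₂ : HasDerivAt g₁ g₂ 0) : iteratedFDeriv ℝ 2 f y ![e, e] = g₂ := by
  have hline : ∀ s : ℝ, HasDerivAt (fun s : ℝ => y + s • e) e s := fun s => by
    simpa using ((hasDerivAt_id s).smul_const e).const_add y
  have hcont : Filter.Tendsto (fun s : ℝ => y + s • e) (nhds 0) (nhds y) := by
    simpa using (hline 0).continuousAt.tendsto
  have hev : ∀ᶠ z in nhds y, ContDiffAt ℝ 2 f z := hf.eventually (by simp)
  have h3 : g₁ =ᶠ[nhds 0] fun s : ℝ => fderiv ℝ f (y + s • e) e := by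
    filter_upwards [h₁, hcont.eventually hev] with s hs hs'
    have := (hs'.differentiableAt (by simp)).hasFDerivAt.comp_hasDerivAt s (hline s)
    exact hs.unique this
  have h4 : HasDerivAt (fun s : ℝ => fderiv ℝ f (y + s • e) e) (fderiv ℝ (fderiv ℝ f) y e e) 0 := by
    have hd : DifferentiableAt ℝ (fderiv ℝ f) y :=
      (hf.fderiv_right (m := 1) (by norm_num)).differentiableAt (by simp)
    have h5 : HasFDerivAt (fderiv ℝ f) (fderiv ℝ (fderiv ℝ f) y) (y + (0 : ℝ) • e) := by
      simpa using hd.hasFDerivAt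
    exact (ContinuousLinearMap.apply ℝ F e).hasFDerivAt.comp_hasDerivAt 0
      (h5.comp_hasDerivAt 0 (hline 0))
  rw [iteratedFDeriv_two_apply]
  exact (h4.congr_of_eventuallyEq h3).unique h₂

/-- The zonal function with profile `p` and pole `x`. -/
noncomputable def zonalFun (p : Polynomial ℝ) (x y : CSphere n) : ℂ :=
  ((p.eval (inner ℝ (x : EuclideanSpace ℂ (Fin n)) (y : EuclideanSpace ℂ (Fin n))) : ℝ) : ℂ)

theorem radialExt_zonalFun (p : Polynomial ℝ) (x : CSphere n) {y : EuclideanSpace ℂ (Fin n)}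
    (hy : y ≠ 0) : radialExt (zonalFun p x) y =
      ((p.eval (‖y‖⁻¹ * inner ℝ (x : EuclideanSpace ℂ (Fin n)) y) : ℝ) : ℂ) := by
  rw [radialExt_of_ne_zero _ hy, zonalFun, inner_smul_right]

theorem isSmooth_zonalFun (p : Polynomial ℝ) (x : CSphere n) : IsSmooth (zonalFun p x) := by
  have h : ContDiffOn ℝ ∞ (fun y : EuclideanSpace ℂ (Fin n) =>
      ((p.eval (‖y‖⁻¹ * inner ℝ (x : EuclideanSpace ℂ (Fin n)) y) : ℝ) : ℂ)) {0}ᶜ := by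
    intro y hy
    have hy' : y ≠ 0 := hy
    have h1 : ContDiffAt ℝ ∞ (fun y : EuclideanSpace ℂ (Fin n) =>
        ‖y‖⁻¹ * inner ℝ (x : EuclideanSpace ℂ (Fin n)) y) y :=
      ((contDiffAt_norm ℝ hy').inv (norm_ne_zero_iff.2 hy')).mul
        (contDiff_const.inner ℝ contDiff_id).contDiffAt
    have h2 : ContDiff ℝ ∞ (fun t : ℝ => p.eval t) := p.contDiff_aeval ∞
    exact (Complex.ofRealCLM.contDiff.contDiffAt.comp y
      (h2.contDiffAt.comp y h1)).contDiffWithinAt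
  exact h.congr fun y hy => radialExt_zonalFun p x hy

theorem finrank_real_euclideanSpace_complex (n : ℕ) :
    Module.finrank ℝ (EuclideanSpace ℂ (Fin n)) = 2 * n := by
  rw [← Module.finrank_mul_finrank ℝ ℂ, Complex.finrank_real_complex, finrank_euclideanSpace_fin]

theorem iteratedFDeriv_two_radialExt_zonalFun (p : Polynomial ℝ) (x y : CSphere n)
    {e : EuclideanSpace ℂ (Fin n)} (he : ‖e‖ = 1) {t a b : ℝ}
    (ht : t = inner ℝ (x : EuclideanSpace ℂ (Fin n)) y)
    (ha : a = inner ℝ (x : EuclideanSpace ℂ (Fin n)) e)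
    (hb : b = inner ℝ (y : EuclideanSpace ℂ (Fin n)) e) :
    iteratedFDeriv ℝ 2 (radialExt (zonalFun p x)) y ![e, e] =
      ((p.derivative.derivative.eval t * (a - t * b) ^ 2 +
        p.derivative.eval t * (3 * t * b ^ 2 - t - 2 * a * b) : ℝ) : ℂ) := by
  have hy : ‖(y : EuclideanSpace ℂ (Fin n))‖ = 1 := by simp
  set w : ℝ → ℝ := fun s => 1 + 2 * s * b + s ^ 2 with hw
  have hwn : ∀ s, ‖(y : EuclideanSpace ℂ (Fin n)) + s • e‖ ^ 2 = w s := fun s => by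
    rw [norm_add_sq_real, norm_smul, hy, he, inner_smul_right, ← hb, hw, Real.norm_eq_abs,
      mul_one, sq_abs]
    ring
  have hw0 : w 0 = 1 := by simp [hw]
  have hwd : ∀ s, HasDerivAt w (2 * b + 2 * s) s := fun s => by
    have h1 := (((hasDerivAt_id s).const_mul 2).mul_const b).const_add 1
    have h2 := h1.add ((hasDerivAt_id s).pow 2)
    refine h2.congr_deriv ?_
    simp
  have hwpos : ∀ᶠ s in nhds (0 : ℝ), 0 < w s :=
    (hwd 0).continuousAt.eventually (lt_mem_nhds (by simp [hw0]))
  -- Since w(s) = ‖y + se‖², τ(s) is the inner product of x with the radial projection of y + se.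
  set τ : ℝ → ℝ := fun s => w s ^ (-(1 / 2) : ℝ) * (t + s * a) with hτ
  set τ' : ℝ → ℝ := fun s => a * w s ^ (-(1 / 2) : ℝ) - (t + s * a) * (b + s) * w s ^ (-(3 / 2) : ℝ)
    with hτ'
  have hlin : ∀ s, HasDerivAt (fun s : ℝ => t + s * a) a s := fun s => by
    simpa using ((hasDerivAt_id s).mul_const a).const_add t
  have hτd : ∀ s, 0 < w s → HasDerivAt τ (τ' s) s := fun s hs => by
    have h1 := (hwd s).rpow_const (p := (-(1 / 2) : ℝ)) (Or.inl hs.ne')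
    refine (h1.mul (hlin s)).congr_deriv ?_
    simp only [hτ']
    rw [show (-(1 / 2) - 1 : ℝ) = -(3 / 2) by norm_num]
    ring
  have hτ'd : HasDerivAt τ' (3 * t * b ^ 2 - t - 2 * a * b) 0 := by
    have h1 := ((hwd 0).rpow_const (p := (-(1 / 2) : ℝ)) (Or.inl (by simp [hw0]))).const_mul a
    have h2 := (hwd 0).rpow_const (p := (-(3 / 2) : ℝ)) (Or.inl (by simp [hw0]))
    have h3 := (hlin 0).mul ((hasDerivAt_id (0 : ℝ)).const_add b)
    refine (h1.sub (h3.mul h2)).congr_deriv ?_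
    simp [hw0]
    ring
  have hτ0 : τ 0 = t := by simp [hτ, hw0]
  have hτ'0 : τ' 0 = a - t * b := by simp [hτ', hw0]
  refine iteratedFDeriv_two_eq_of_line ((isSmooth_zonalFun p x).contDiffAt y)
    (g₁ := fun s => ((p.derivative.eval (τ s) * τ' s : ℝ) : ℂ)) ?_ ?_
  · have heq : ∀ s, 0 < w s → radialExt (zonalFun p x) ((y : EuclideanSpace ℂ (Fin n)) + s • e) =
        ((p.eval (τ s) : ℝ) : ℂ) := fun s hs => by
      have hnz : (y : EuclideanSpace ℂ (Fin n)) + s • e ≠ 0 := fun h0 => by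
        have := hwn s
        rw [h0, norm_zero] at this
        simp at this
        linarith
      rw [radialExt_zonalFun p x hnz, inner_add_right, inner_smul_right, ← ht, ← ha, hτ]
      congr 3
      rw [← hwn s, ← Real.rpow_natCast, ← Real.rpow_mul (norm_nonneg _)]
      norm_num
      rw [Real.rpow_neg_one]
    filter_upwards [hwpos.eventually_nhds] with s hs
    have h1 := ((p.hasDerivAt (τ s)).comp s (hτd s hs.self_of_nhds)).ofReal_comp
    refine h1.congr_of_eventuallyEq ?_
    filter_upwards [hs] with r hr
    exact heq r hr
  · have h1 := (((p.derivative.hasDerivAt (τ 0)).comp 0 (hτd 0 (by simp [hw0]))).mul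
      hτ'd).ofReal_comp
    refine h1.congr_deriv ?_
    simp only [Function.comp_apply, hτ0, hτ'0]
    congr 1
    ring

theorem laplaceBeltrami_zonalFun (p : Polynomial ℝ) (x y : CSphere n) {t : ℝ}
    (ht : t = inner ℝ (x : EuclideanSpace ℂ (Fin n)) y) :
    laplaceBeltrami (zonalFun p x) y =
      -(((1 - t ^ 2) * p.derivative.derivative.eval t
        - (2 * n - 1) * t * p.derivative.eval t : ℝ) : ℂ) := by
  set B := stdOrthonormalBasis ℝ (EuclideanSpace ℂ (Fin n)) with hB
  have h1 : ∀ i, ‖B i‖ = 1 := fun i => B.orthonormal.1 i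
  -- Parseval: summing over the basis replaces a², ab, b² by 1, t, 1, and the constant term is
  -- counted 2n times.
  have hsum : ∀ u v : EuclideanSpace ℂ (Fin n),
      ∑ i, inner ℝ u (B i) * inner ℝ v (B i) = inner ℝ u v := fun u v => by
    rw [← B.sum_inner_mul_inner u v]
    exact Finset.sum_congr rfl fun i _ => by rw [real_inner_comm v]
  have hxx := hsum x x
  have hyy := hsum y y
  have hxy := hsum x y
  rw [real_inner_self_eq_norm_sq, norm_eq_of_mem_sphere, one_pow] at hxx hyy
  rw [← ht] at hxy
  have hcard : ∑ i : Fin (Module.finrank ℝ (EuclideanSpace ℂ (Fin n))), (1 : ℝ) = 2 * n := by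
    simp [finrank_real_euclideanSpace_complex]
  rw [laplaceBeltrami, InnerProductSpace.laplacian_eq_iteratedFDeriv_orthonormalBasis _ B]
  congr 1
  simp only []
  rw [Finset.sum_congr rfl fun i _ =>
    iteratedFDeriv_two_radialExt_zonalFun p x y (h1 i) ht rfl rfl]
  rw [← Complex.ofReal_sum]
  congr 1
  set P := p.derivative.derivative.eval t
  set Q := p.derivative.eval t
  calc _ = P * (∑ i, inner ℝ (x : EuclideanSpace ℂ (Fin n)) (B i) *
          inner ℝ (x : EuclideanSpace ℂ (Fin n)) (B i))
        + (-2 * t * P - 2 * Q) * (∑ i, inner ℝ (x : EuclideanSpace ℂ (Fin n)) (B i) *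
          inner ℝ (y : EuclideanSpace ℂ (Fin n)) (B i))
        + (t ^ 2 * P + 3 * t * Q) * (∑ i, inner ℝ (y : EuclideanSpace ℂ (Fin n)) (B i) *
          inner ℝ (y : EuclideanSpace ℂ (Fin n)) (B i))
        - t * Q * ∑ i : Fin (Module.finrank ℝ (EuclideanSpace ℂ (Fin n))), (1 : ℝ) := by
        simp only [Finset.mul_sum, ← Finset.sum_add_distrib, ← Finset.sum_sub_distrib]
        exact Finset.sum_congr rfl fun i _ => by ring
    _ = _ := by
        rw [hxx, hxy, hyy, hcard]
        ring

/-- Zonal harmonics of degree `j` are eigenfunctions for the eigenvalue `θ_j`. -/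
theorem zonalFun_zonal_mem_eigenspace (hn : 1 ≤ n) (j : ℕ) (x : CSphere n) :
    zonalFun (zonal n j) x ∈ eigenspace n j := by
  refine ⟨isSmooth_zonalFun _ x, fun y => ?_⟩
  rw [laplaceBeltrami_zonalFun _ x y rfl, zonalFun, theta_eq n j hn, ← Complex.ofReal_neg,
    ← Complex.ofReal_mul]
  congr 1
  obtain ⟨m, rfl⟩ : ∃ m, n = m + 1 := ⟨n - 1, by omega⟩
  have h := congrArg (Polynomial.eval (inner ℝ (x : EuclideanSpace ℂ (Fin (m + 1)))
    (y : EuclideanSpace ℂ (Fin (m + 1))))) (zonal_ode m j)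
  simp only [Polynomial.eval_add, Polynomial.eval_sub, Polynomial.eval_mul, Polynomial.eval_one,
    Polynomial.eval_pow, Polynomial.eval_X, Polynomial.eval_ofNat, Polynomial.eval_natCast,
    Polynomial.eval_zero] at h
  push_cast
  linear_combination -h

end Geometry

/-! ### Green's formula and orthogonality of eigenspaces. -/

section Green

variable {n : ℕ}

theorem contDiffAt_radialExt {u : CSphere n → ℂ} (hu : IsSmooth u) {x : EuclideanSpace ℂ (Fin n)}
    (hx : x ≠ 0) : ContDiffAt ℝ ∞ (radialExt u) x :=
  ContDiffOn.contDiffAt hu (isOpen_compl_singleton.mem_nhds hx)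

theorem IsSmooth.continuous {u : CSphere n → ℂ} (hu : IsSmooth u) : Continuous u := by
  have h : u = fun x : CSphere n => radialExt u x := funext fun x => (radialExt_coe u x).symm
  rw [h, continuous_iff_continuousAt]
  exact fun x => (contDiffAt_radialExt hu (coe_ne_zero x)).continuousAt.comp
    continuous_subtype_val.continuousAt

theorem fderiv_radialExt_self {u : CSphere n → ℂ} (hu : IsSmooth u)
    {x : EuclideanSpace ℂ (Fin n)} (hx : x ≠ 0) : fderiv ℝ (radialExt u) x x = 0 := by
  have hd := ((contDiffAt_radialExt hu hx).differentiableAt (by simp)).hasFDerivAt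
  have hl : HasDerivAt (fun s : ℝ => s • x) x 1 := by
    simpa using (hasDerivAt_id (1 : ℝ)).smul_const x
  have h1 : HasDerivAt (fun s : ℝ => radialExt u (s • x)) (fderiv ℝ (radialExt u) x x) 1 := by
    have hd' : HasFDerivAt (radialExt u) (fderiv ℝ (radialExt u) x) ((1 : ℝ) • x) := by
      simpa using hd
    exact hd'.comp_hasDerivAt 1 hl
  have h2 : (fun s : ℝ => radialExt u (s • x)) =ᶠ[nhds 1] fun _ => radialExt u x := by
    filter_upwards [lt_mem_nhds (zero_lt_one' ℝ)] with s hs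
    exact radialExt_smul_of_pos u hs x
  exact (h1.congr_of_eventuallyEq h2.symm).unique (hasDerivAt_const _ _)

theorem laplacian_radialExt_smul (u : CSphere n → ℂ) {c : ℝ} (hc : 0 < c)
    (x : EuclideanSpace ℂ (Fin n)) :
    (c : ℂ) ^ 2 * (Δ (radialExt u)) (c • x) = (Δ (radialExt u)) x := by
  have h1 : fderiv ℝ (radialExt u) = fun y => c • fderiv ℝ (radialExt u) (c • y) := by
    funext y
    rw [← fderiv_comp_smul]
    exact congrArg (fderiv ℝ · y) (funext fun z => (radialExt_smul_of_pos u hc z).symm)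
  have h2 : fderiv ℝ (fderiv ℝ (radialExt u)) x =
      c • c • fderiv ℝ (fderiv ℝ (radialExt u)) (c • x) := by
    conv_lhs => rw [h1]
    have h3 := congrFun (fderiv_const_smul_field (𝕜 := ℝ)
      (f := fun y => fderiv ℝ (radialExt u) (c • y)) c) x
    rw [Pi.smul_apply, fderiv_comp_smul] at h3
    exact h3
  simp only [InnerProductSpace.laplacian_eq_iteratedFDeriv_stdOrthonormalBasis,
    iteratedFDeriv_two_apply]
  rw [h2, Finset.mul_sum]
  refine Finset.sum_congr rfl fun i _ => ?_
  simp [sq, mul_assoc]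

/-- A smooth radial cutoff supported in a shell around the unit sphere. -/
noncomputable def shellBump : ContDiffBump (1 : ℝ) := ⟨1 / 4, 1 / 2, by norm_num, by norm_num⟩

/-- The cutoff `shellBump` of the squared norm. -/
noncomputable def shellCutoff (n : ℕ) (x : EuclideanSpace ℂ (Fin n)) : ℝ := shellBump (‖x‖ ^ 2)

theorem contDiff_shellCutoff (n : ℕ) : ContDiff ℝ ∞ (shellCutoff n) :=
  shellBump.contDiff.comp (contDiff_norm_sq ℝ)

theorem shellCutoff_eventually_zero (n : ℕ) : shellCutoff n =ᶠ[nhds 0] fun _ => 0 := by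
  have h : Filter.Tendsto (fun x : EuclideanSpace ℂ (Fin n) => ‖x‖ ^ 2) (nhds 0) (nhds 0) := by
    have : Continuous (fun x : EuclideanSpace ℂ (Fin n) => ‖x‖ ^ 2) := by fun_prop
    simpa using this.tendsto 0
  filter_upwards [h.eventually (gt_mem_nhds (show (0 : ℝ) < 1 / 2 by norm_num))] with x hx
  apply shellBump.zero_of_le_dist
  rw [Real.dist_eq, abs_sub_comm, abs_of_nonneg (by linarith)]
  simp only [shellBump]
  linarith

theorem hasCompactSupport_shellCutoff (n : ℕ) : HasCompactSupport (shellCutoff n) := by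
  refine HasCompactSupport.intro (isCompact_closedBall (0 : EuclideanSpace ℂ (Fin n)) 2)
    fun x hx => ?_
  have h2 : 2 < ‖x‖ := by simpa using hx
  apply shellBump.zero_of_le_dist
  rw [Real.dist_eq, abs_of_nonneg (by nlinarith)]
  simp only [shellBump]
  nlinarith

theorem fderiv_shellCutoff (x v : EuclideanSpace ℂ (Fin n)) :
    fderiv ℝ (shellCutoff n) x v = deriv shellBump (‖x‖ ^ 2) * (2 * inner ℝ x v) := by
  have h1 : HasDerivAt shellBump (deriv shellBump (‖x‖ ^ 2)) (‖x‖ ^ 2) :=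
    ((shellBump.contDiff (n := 1)).differentiable (by simp) _).hasDerivAt
  have h2 := h1.comp_hasFDerivAt x (hasStrictFDerivAt_norm_sq x).hasFDerivAt
  have h3 : fderiv ℝ (shellCutoff n) x = _ := h2.fderiv
  rw [h3]
  simp

/-- The cut-off flux `χ (V ∂_e U - U ∂_e V)` of two radially constant extensions. -/
noncomputable def shellFlux (u v : CSphere n → ℂ) (e x : EuclideanSpace ℂ (Fin n)) : ℂ :=
  (shellCutoff n x : ℂ) * (radialExt v x * fderiv ℝ (radialExt u) x e -
    radialExt u x * fderiv ℝ (radialExt v) x e)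

theorem contDiffAt_fderiv_radialExt {u : CSphere n → ℂ} (hu : IsSmooth u)
    {x : EuclideanSpace ℂ (Fin n)} (hx : x ≠ 0) (e : EuclideanSpace ℂ (Fin n)) :
    ContDiffAt ℝ 1 (fun x => fderiv ℝ (radialExt u) x e) x :=
  (((contDiffAt_radialExt hu hx).of_le (m := 2) (WithTop.coe_le_coe.2 le_top)).fderiv_right
    (m := 1) (by norm_num)).clm_apply contDiffAt_const

theorem contDiff_shellFlux {u v : CSphere n → ℂ} (hu : IsSmooth u) (hv : IsSmooth v)
    (e : EuclideanSpace ℂ (Fin n)) : ContDiff ℝ 1 (shellFlux u v e) := by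
  rw [contDiff_iff_contDiffAt]
  intro x
  by_cases hx : x = 0
  · have h : shellFlux u v e =ᶠ[nhds x] fun _ => 0 := by
      rw [hx]
      filter_upwards [shellCutoff_eventually_zero n] with y hy
      simp [shellFlux, hy]
    exact contDiffAt_const.congr_of_eventuallyEq h
  · have h1 : ∀ {w : CSphere n → ℂ}, IsSmooth w → ContDiffAt ℝ 1 (radialExt w) x := fun hw =>
      (contDiffAt_radialExt hw hx).of_le (WithTop.coe_le_coe.2 le_top)
    have h2 : ContDiffAt ℝ 1 (fun x => (shellCutoff n x : ℂ)) x :=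
      Complex.ofRealCLM.contDiff.contDiffAt.comp x
        (((contDiff_shellCutoff n).of_le (WithTop.coe_le_coe.2 le_top)).contDiffAt)
    exact h2.mul (((h1 hv).mul (contDiffAt_fderiv_radialExt hu hx e)).sub
      ((h1 hu).mul (contDiffAt_fderiv_radialExt hv hx e)))

theorem integral_fderiv_shellFlux {u v : CSphere n → ℂ} (hu : IsSmooth u) (hv : IsSmooth v)
    (e : EuclideanSpace ℂ (Fin n)) :
    Integrable (fun x => fderiv ℝ (shellFlux u v e) x e) ∧
      ∫ x, fderiv ℝ (shellFlux u v e) x e = 0 := by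
  have hc := contDiff_shellFlux hu hv e
  have hs : HasCompactSupport (shellFlux u v e) :=
    ((hasCompactSupport_shellCutoff n).comp_left (g := ((↑) : ℝ → ℂ)) (by simp)).mul_right
  have h1 : Integrable (shellFlux u v e) := hc.continuous.integrable_of_hasCompactSupport hs
  have h2 : Integrable (fun x => fderiv ℝ (shellFlux u v e) x e) :=
    ((hc.continuous_fderiv (by simp)).clm_apply continuous_const).integrable_of_hasCompactSupport
      (hs.fderiv_apply ℝ e)
  refine ⟨h2, ?_⟩
  have := integral_mul_fderiv_eq_neg_fderiv_mul_of_integrable (μ := volume)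
    (f := fun _ : EuclideanSpace ℂ (Fin n) => (1 : ℂ)) (g := shellFlux u v e) (v := e)
    (by simp) (by simpa using h2) (by simpa using h1) (fun x _ => by fun_prop)
    (fun x _ => (hc.differentiable (by simp)) x)
  simpa using this

/-- The gradient of the cutoff is radial and the extensions are constant along rays, so the
derivative of the cutoff contributes nothing; the products of first derivatives cancel by
antisymmetry. -/
theorem sum_fderiv_shellFlux {u v : CSphere n → ℂ} (hu : IsSmooth u) (hv : IsSmooth v)
    {x : EuclideanSpace ℂ (Fin n)} (hx : x ≠ 0) :
    ∑ i, fderiv ℝ (shellFlux u v (stdOrthonormalBasis ℝ (EuclideanSpace ℂ (Fin n)) i)) x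
        (stdOrthonormalBasis ℝ (EuclideanSpace ℂ (Fin n)) i) =
      (shellCutoff n x : ℂ) * (radialExt v x * (Δ (radialExt u)) x -
        radialExt u x * (Δ (radialExt v)) x) := by
  set B := stdOrthonormalBasis ℝ (EuclideanSpace ℂ (Fin n)) with hB
  set U := radialExt u
  set V := radialExt v
  have hterm : ∀ i, fderiv ℝ (shellFlux u v (B i)) x (B i) =
      ((fderiv ℝ (shellCutoff n) x (B i) : ℝ) : ℂ) *
        (V x * fderiv ℝ U x (B i) - U x * fderiv ℝ V x (B i)) +
      (shellCutoff n x : ℂ) * (V x * fderiv ℝ (fderiv ℝ U) x (B i) (B i) -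
        U x * fderiv ℝ (fderiv ℝ V) x (B i) (B i)) := by
    intro i
    have hD : ∀ {w : CSphere n → ℂ}, IsSmooth w →
        HasFDerivAt (radialExt w) (fderiv ℝ (radialExt w) x) x := fun hw =>
      ((contDiffAt_radialExt hw hx).differentiableAt (by simp)).hasFDerivAt
    have hDD : ∀ {w : CSphere n → ℂ}, IsSmooth w →
        HasFDerivAt (fun y => fderiv ℝ (radialExt w) y (B i))
          ((ContinuousLinearMap.apply ℝ ℂ (B i)).comp (fderiv ℝ (fderiv ℝ (radialExt w)) x)) x := by
      intro w hw
      have h1 : DifferentiableAt ℝ (fderiv ℝ (radialExt w)) x :=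
        (((contDiffAt_radialExt hw hx).of_le (m := 2) (WithTop.coe_le_coe.2 le_top)).fderiv_right
          (m := 1) (by norm_num)).differentiableAt (by simp)
      exact (ContinuousLinearMap.apply ℝ ℂ (B i)).hasFDerivAt.comp x h1.hasFDerivAt
    have hC : HasFDerivAt (fun y => (shellCutoff n y : ℂ))
        (Complex.ofRealCLM.comp (fderiv ℝ (shellCutoff n) x)) x :=
      Complex.ofRealCLM.hasFDerivAt.comp x
        ((contDiff_shellCutoff n).differentiable (by simp) x).hasFDerivAt
    have h := hC.mul (((hD hv).mul (hDD hu)).sub ((hD hu).mul (hDD hv)))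
    have h' : fderiv ℝ (shellFlux u v (B i)) x = _ := h.fderiv
    rw [h']
    simp
    ring
  have hrad : ∀ {w : CSphere n → ℂ}, IsSmooth w → ∑ i, ((fderiv ℝ (shellCutoff n) x (B i) : ℝ) : ℂ) *
      fderiv ℝ (radialExt w) x (B i) = 0 := by
    intro w hw
    have h1 := fderiv_radialExt_self hw hx
    have h2 : fderiv ℝ (radialExt w) x x =
        ∑ i, ((inner ℝ x (B i) : ℝ) : ℂ) * fderiv ℝ (radialExt w) x (B i) := by
      conv_lhs => enter [2]; rw [← B.sum_repr' x]
      rw [map_sum]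
      refine Finset.sum_congr rfl fun i _ => ?_
      rw [map_smul, real_inner_comm, Complex.real_smul]
    rw [h1] at h2
    calc _ = ((deriv shellBump (‖x‖ ^ 2) * 2 : ℝ) : ℂ) *
          ∑ i, ((inner ℝ x (B i) : ℝ) : ℂ) * fderiv ℝ (radialExt w) x (B i) := by
          rw [Finset.mul_sum]
          refine Finset.sum_congr rfl fun i _ => ?_
          rw [fderiv_shellCutoff]
          push_cast
          ring
      _ = 0 := by rw [← h2, mul_zero]
  have hlap : ∀ w : EuclideanSpace ℂ (Fin n) → ℂ, (Δ w) x =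
      ∑ i, fderiv ℝ (fderiv ℝ w) x (B i) (B i) := fun w => by
    rw [InnerProductSpace.laplacian_eq_iteratedFDeriv_orthonormalBasis w B]
    simp [iteratedFDeriv_two_apply]
  rw [Finset.sum_congr rfl fun i _ => hterm i, hlap, hlap]
  have e1 := hrad hu
  have e2 := hrad hv
  calc _ = V x * (∑ i, ((fderiv ℝ (shellCutoff n) x (B i) : ℝ) : ℂ) * fderiv ℝ U x (B i))
        - U x * (∑ i, ((fderiv ℝ (shellCutoff n) x (B i) : ℝ) : ℂ) * fderiv ℝ V x (B i))
        + (shellCutoff n x : ℂ) * (V x * ∑ i, fderiv ℝ (fderiv ℝ U) x (B i) (B i) -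
          U x * ∑ i, fderiv ℝ (fderiv ℝ V) x (B i) (B i)) := by
        simp only [Finset.mul_sum, ← Finset.sum_add_distrib, ← Finset.sum_sub_distrib]
        exact Finset.sum_congr rfl fun i _ => by ring
    _ = _ := by rw [e1, e2]; ring

theorem integral_polar (A : CSphere n → ℂ) (b : ℝ → ℂ) (f : EuclideanSpace ℂ (Fin n) → ℂ)
    (hf : ∀ (r : ℝ) (y : CSphere n), 0 < r → f (r • (y : EuclideanSpace ℂ (Fin n))) = A y * b r)
    (hn : 1 ≤ n) :
    ∫ x, f x = (∫ y, A y ∂(volume : Measure (EuclideanSpace ℂ (Fin n))).toSphere) *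
      ∫ r : Set.Ioi (0 : ℝ), b r ∂(Measure.volumeIoiPow
        (Module.finrank ℝ (EuclideanSpace ℂ (Fin n)) - 1)) := by
  set μ : Measure (EuclideanSpace ℂ (Fin n)) := volume
  have : Nonempty (Fin n) := ⟨⟨0, hn⟩⟩
  calc ∫ x, f x ∂μ = ∫ x : ({(0)}ᶜ : Set (EuclideanSpace ℂ (Fin n))), f x.1 ∂(μ.comap (↑)) := by
        rw [integral_subtype_comap (measurableSet_singleton _).compl f,
          restrict_compl_singleton]
    _ = ∫ x, A x.1 * b x.2 ∂μ.toSphere.prod (.volumeIoiPow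
          (Module.finrank ℝ (EuclideanSpace ℂ (Fin n)) - 1)) := by
        rw [← μ.measurePreserving_homeomorphUnitSphereProd.integral_comp
          (Homeomorph.measurableEmbedding _)]
        refine integral_congr_ae (Filter.Eventually.of_forall fun x => ?_)
        have hx : ‖(x : EuclideanSpace ℂ (Fin n))‖ ≠ 0 := norm_ne_zero_iff.2 x.2
        have h1 := hf ((homeomorphUnitSphereProd (EuclideanSpace ℂ (Fin n))) x).2
          ((homeomorphUnitSphereProd (EuclideanSpace ℂ (Fin n))) x).1 (Subtype.mem _)
        refine Eq.trans ?_ h1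
        simp [smul_smul, hx]
    _ = _ := integral_prod_mul A (fun r : Set.Ioi (0 : ℝ) => b r)

theorem integral_shell_ne_zero (hn : 1 ≤ n) :
    ∫ r : Set.Ioi (0 : ℝ), ((shellBump ((r : ℝ) ^ 2) * ((r : ℝ) ^ 2)⁻¹ : ℝ) : ℂ)
      ∂(Measure.volumeIoiPow (Module.finrank ℝ (EuclideanSpace ℂ (Fin n)) - 1)) ≠ 0 := by
  intro h0
  have : Nonempty (Fin n) := ⟨⟨0, hn⟩⟩
  -- If the radial factor vanished, so would the integral over ℂⁿ of a continuous nonnegative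
  -- function that equals 1 on the unit sphere.
  have h1 := integral_polar (n := n) (fun _ => 1)
    (fun r => ((shellBump (r ^ 2) * (r ^ 2)⁻¹ : ℝ) : ℂ))
    (fun x => ((shellCutoff n x * (‖x‖ ^ 2)⁻¹ : ℝ) : ℂ)) (fun r y hr => by
      simp [shellCutoff, norm_smul, abs_of_pos hr]) hn
  rw [h0, mul_zero, integral_complex_ofReal, Complex.ofReal_eq_zero] at h1
  have hcont : Continuous fun x : EuclideanSpace ℂ (Fin n) => shellCutoff n x * (‖x‖ ^ 2)⁻¹ := by
    rw [continuous_iff_continuousAt]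
    intro x
    by_cases hx : x = 0
    · refine (continuousAt_const (y := (0 : ℝ))).congr ?_
      rw [hx]
      filter_upwards [shellCutoff_eventually_zero n] with y hy
      simp [hy]
    · exact (contDiff_shellCutoff n).continuous.continuousAt.mul
        (ContinuousAt.inv₀ (by fun_prop) (pow_ne_zero _ (norm_ne_zero_iff.2 hx)))
  obtain ⟨x₀, hx₀⟩ := (NormedSpace.sphere_nonempty (x := (0 : EuclideanSpace ℂ (Fin n)))
    (r := 1)).2 zero_le_one
  have hpos := hcont.integral_pos_of_hasCompactSupport_nonneg_nonzero (μ := volume)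
    (hasCompactSupport_shellCutoff n).mul_right
    (fun x => mul_nonneg shellBump.nonneg (by positivity)) (x := x₀) (by
      have : ‖x₀‖ = 1 := by simpa using hx₀
      have h2 : shellBump 1 = 1 := shellBump.one_of_mem_closedBall (by
        simp [shellBump])
      simp [shellCutoff, this, h2])
  exact hpos.ne' h1

/-- The Laplace-Beltrami operator is symmetric. -/
theorem integral_green (hn : 1 ≤ n) {u v : CSphere n → ℂ} (hu : IsSmooth u) (hv : IsSmooth v) :
    ∫ y, (v y * laplaceBeltrami u y - u y * laplaceBeltrami v y) ∂(nu n) = 0 := by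
  have : Nonempty (Fin n) := ⟨⟨0, hn⟩⟩
  set B := stdOrthonormalBasis ℝ (EuclideanSpace ℂ (Fin n)) with hB
  have h1 : ∫ x, (shellCutoff n x : ℂ) * (radialExt v x * (Δ (radialExt u)) x -
      radialExt u x * (Δ (radialExt v)) x) = 0 := by
    calc _ = ∫ x, ∑ i, fderiv ℝ (shellFlux u v (B i)) x (B i) := by
          refine integral_congr_ae ?_
          have : ∀ᵐ x : EuclideanSpace ℂ (Fin n), x ≠ 0 := by
            simp [ae_iff]
          filter_upwards [this] with x hx
          exact (sum_fderiv_shellFlux hu hv hx).symm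
      _ = 0 := by
          rw [integral_finsetSum _ fun i _ => (integral_fderiv_shellFlux hu hv (B i)).1]
          exact Finset.sum_eq_zero fun i _ => (integral_fderiv_shellFlux hu hv (B i)).2
  -- The Laplacian of a radially constant function is homogeneous of degree -2, so the ambient
  -- integral splits into the spherical one times a nonzero radial factor.
  rw [integral_polar (fun y => -(v y * laplaceBeltrami u y - u y * laplaceBeltrami v y))
    (fun r => ((shellBump (r ^ 2) * (r ^ 2)⁻¹ : ℝ) : ℂ)) _ ?_ hn, mul_eq_zero,
    or_iff_left (integral_shell_ne_zero hn), integral_neg, neg_eq_zero] at h1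
  · rw [nu, integral_smul_measure, h1, smul_zero]
  · intro r y hr
    have hr' : (r : ℂ) ≠ 0 := by exact_mod_cast hr.ne'
    have hl : ∀ w : CSphere n → ℂ, (Δ (radialExt w)) (r • (y : EuclideanSpace ℂ (Fin n))) =
        -((r : ℂ) ^ 2)⁻¹ * laplaceBeltrami w y := fun w => by
      have := laplacian_radialExt_smul w hr (y : EuclideanSpace ℂ (Fin n))
      rw [laplaceBeltrami, ← this]
      field_simp
    have hc : shellCutoff n (r • (y : EuclideanSpace ℂ (Fin n))) = shellBump (r ^ 2) := by
      simp [shellCutoff, norm_smul, abs_of_pos hr]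
    rw [hl, hl, hc, radialExt_smul_of_pos _ hr, radialExt_smul_of_pos _ hr, radialExt_coe,
      radialExt_coe]
    push_cast
    ring

theorem theta_injective (hn : 1 ≤ n) : Function.Injective (theta n) := by
  have hn1 : (1 : ℝ) ≤ n := by exact_mod_cast hn
  refine StrictMono.injective (strictMono_nat_of_lt_succ fun k => ?_)
  rw [theta_eq n _ hn, theta_eq n _ hn]
  push_cast
  nlinarith [(Nat.cast_nonneg k : (0 : ℝ) ≤ k)]

instance isProbabilityMeasure_nu [NeZero n] : IsProbabilityMeasure (nu n) := by
  have : Nonempty (Fin n) := ⟨⟨0, Nat.pos_of_ne_zero (NeZero.ne n)⟩⟩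
  refine ⟨?_⟩
  rw [nu, Measure.smul_apply, smul_eq_mul]
  exact ENNReal.inv_mul_cancel (by
    rw [Ne, Measure.measure_univ_eq_zero]; exact Measure.toSphere_ne_zero _)
    (measure_ne_top _ _)

theorem integrable_of_continuous [NeZero n] {E : Type*} [NormedAddCommGroup E]
    {f : CSphere n → E} (hf : Continuous f) : Integrable f (nu n) :=
  hf.integrable_of_hasCompactSupport (HasCompactSupport.of_compactSpace f)

/-- Eigenspaces for different eigenvalues are orthogonal. -/
theorem integral_mul_eq_zero_of_mem_eigenspace [NeZero n] {j k : ℕ} (hjk : j ≠ k)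
    {u v : CSphere n → ℂ} (hu : u ∈ eigenspace n j) (hv : v ∈ eigenspace n k) :
    ∫ y, u y * v y ∂(nu n) = 0 := by
  have hn : 1 ≤ n := Nat.one_le_iff_ne_zero.2 (NeZero.ne n)
  have h := integral_green hn hu.1 hv.1
  have h1 : ∀ y, v y * laplaceBeltrami u y - u y * laplaceBeltrami v y =
      ((theta n j : ℂ) - theta n k) * (u y * v y) := fun y => by
    rw [hu.2 y, hv.2 y]; ring
  simp only [h1] at h
  rw [integral_const_mul, mul_eq_zero] at h
  refine h.resolve_left (sub_ne_zero.2 fun he => hjk (theta_injective hn ?_))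
  exact_mod_cast he

end Green

/-! ### Integrals of kernels with values in a finite-dimensional space. -/

section Kernel

/-- Integrating a kernel whose sections lie in a finite-dimensional space of functions gives an
element of that space. -/
theorem integral_kernel_mem {X Y : Type*} [MeasurableSpace Y] {μ : Measure Y}
    (W : Submodule ℂ (X → ℂ)) [FiniteDimensional ℂ W] (k : X → Y → ℂ)
    (hk : ∀ y, (fun x => k x y) ∈ W) (f : Y → ℂ)
    (hint : ∀ x, Integrable (fun y => k x y * f y) μ) :
    (fun x => ∫ y, k x y * f y ∂μ) ∈ W := by
  set κ : Y → W := fun y => ⟨fun x => k x y, hk y⟩ with hκ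
  -- Only a zero function is killed by all point evaluations, so these span the dual. Integrability,
  -- assumed for evaluations, thereby passes to the coordinate functionals.
  set ev : X → Module.Dual ℂ W := fun x => (LinearMap.proj x).comp W.subtype with hev
  have htop : Submodule.span ℂ (Set.range ev) = ⊤ := by
    have h0 : (Submodule.span ℂ (Set.range ev)).dualCoannihilator = ⊥ := by
      rw [Submodule.eq_bot_iff]
      intro w hw
      rw [Submodule.mem_dualCoannihilator] at hw
      ext x
      exact hw (ev x) (Submodule.subset_span ⟨x, rfl⟩)
    rw [← Subspace.dualCoannihilator_dualAnnihilator_eq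
      (W := Submodule.span ℂ (Set.range ev)), h0, Submodule.dualAnnihilator_bot]
  have hφ : ∀ φ : Module.Dual ℂ W, Integrable (fun y => φ (κ y) * f y) μ := by
    intro φ
    have hmem : φ ∈ Submodule.span ℂ (Set.range ev) := htop ▸ Submodule.mem_top
    induction hmem using Submodule.span_induction with
    | mem φ h =>
      obtain ⟨x, rfl⟩ := h
      exact hint x
    | zero => simp
    | add φ ψ _ _ h1 h2 =>
      simp only [LinearMap.add_apply, add_mul]
      exact h1.add h2
    | smul c φ _ h => simpa [mul_assoc] using h.const_mul c
  set b := Module.finBasis ℂ W with hb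
  have hsum : (fun x => ∫ y, k x y * f y ∂μ) =
      ((∑ i, (∫ y, b.coord i (κ y) * f y ∂μ) • b i : W) : X → ℂ) := by
    funext x
    have h1 : ∀ y, k x y * f y = ∑ i, (b.coord i (κ y) * f y) * (b i : X → ℂ) x := fun y => by
      have h2 : k x y = ((∑ i, b.coord i (κ y) • b i : W) : X → ℂ) x := by
        simp only [Module.Basis.coord_apply]
        rw [b.sum_repr]
      rw [h2, Submodule.coe_sum, Finset.sum_apply, Finset.sum_mul]
      exact Finset.sum_congr rfl fun i _ => by
        rw [Submodule.coe_smul, Pi.smul_apply, smul_eq_mul, mul_right_comm]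
    simp only [h1]
    rw [integral_finsetSum _ fun i _ => (hφ (b.coord i)).mul_const _]
    simp [integral_mul_const]
  rw [hsum]
  exact Subtype.mem _

end Kernel

/-! ### Convolution with zonal kernels. -/

section Zonal

variable {n : ℕ}

theorem abs_inner_le_one (x y : CSphere n) :
    |inner ℝ (x : EuclideanSpace ℂ (Fin n)) (y : EuclideanSpace ℂ (Fin n))| ≤ 1 := by
  simpa using abs_real_inner_le_norm (x : EuclideanSpace ℂ (Fin n)) (y : EuclideanSpace ℂ (Fin n))

theorem zonalFun_comm (p : Polynomial ℝ) (x y : CSphere n) : zonalFun p x y = zonalFun p y x := by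
  rw [zonalFun, zonalFun, real_inner_comm]

theorem continuous_zonalFun (p : Polynomial ℝ) :
    Continuous fun q : CSphere n × CSphere n => zonalFun p q.1 q.2 := by
  unfold zonalFun
  have h : Continuous fun q : CSphere n × CSphere n =>
    inner ℝ (q.1 : EuclideanSpace ℂ (Fin n)) (q.2 : EuclideanSpace ℂ (Fin n)) := by fun_prop
  exact Complex.continuous_ofReal.comp (p.continuous.comp h)

theorem continuous_zonalFun_right (p : Polynomial ℝ) (x : CSphere n) :
    Continuous (zonalFun p x) := (isSmooth_zonalFun p x).continuous

theorem exists_zonalFun_bound (p : Polynomial ℝ) :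
    ∃ C : ℝ, 0 ≤ C ∧ ∀ x y : CSphere n, ‖zonalFun p x y‖ ≤ C := by
  obtain ⟨C, hC⟩ := (isCompact_univ (X := CSphere n × CSphere n)).exists_bound_of_continuousOn
    (continuous_zonalFun p).continuousOn
  exact ⟨max C 0, le_max_right _ _, fun x y => (hC (x, y) trivial).trans (le_max_left _ _)⟩

/-- Powers of the inner product expand into finitely many monomials in real coordinates. With
`integral_kernel_mem` this puts zonal convolutions in the eigenspace without knowing its dimension.
-/
theorem finiteDimensional_span_zonalFun (p : Polynomial ℝ) :
    FiniteDimensional ℂ (Submodule.span ℂ (Set.range fun y : CSphere n => zonalFun p y)) := by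
  set B := stdOrthonormalBasis ℝ (EuclideanSpace ℂ (Fin n)) with hB
  let mon : (Σ i : Fin (p.natDegree + 1), (Fin i → Fin (Module.finrank ℝ
    (EuclideanSpace ℂ (Fin n))))) → CSphere n → ℂ := fun q x =>
      ∏ l, ((inner ℝ (B (q.2 l)) (x : EuclideanSpace ℂ (Fin n)) : ℝ) : ℂ)
  have hle : Submodule.span ℂ (Set.range fun y : CSphere n => zonalFun p y) ≤
      Submodule.span ℂ (Set.range mon) := by
    rw [Submodule.span_le]
    rintro _ ⟨y, rfl⟩
    have h1 : zonalFun p y = ∑ i : Fin (p.natDegree + 1),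
        ∑ q : Fin i → Fin (Module.finrank ℝ (EuclideanSpace ℂ (Fin n))),
          ((p.coeff i * ∏ l, inner ℝ (y : EuclideanSpace ℂ (Fin n)) (B (q l)) : ℝ) : ℂ) •
            mon ⟨i, q⟩ := by
      funext x
      rw [zonalFun, Polynomial.eval_eq_sum_range, Finset.sum_range, ← B.sum_inner_mul_inner]
      simp only [Fintype.sum_pow, Finset.prod_mul_distrib, Finset.sum_apply, Pi.smul_apply,
        smul_eq_mul, mon]
      push_cast
      simp only [Finset.mul_sum, mul_assoc]
    simp only [SetLike.mem_coe]
    rw [h1]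
    exact Submodule.sum_mem _ fun i _ => Submodule.sum_mem _ fun q _ =>
      Submodule.smul_mem _ _ (Submodule.subset_span ⟨_, rfl⟩)
  have : FiniteDimensional ℂ (Submodule.span ℂ (Set.range mon)) :=
    FiniteDimensional.span_of_finite ℂ (Set.finite_range mon)
  exact Submodule.finiteDimensional_of_le hle

/-- The convolution of `f` with the zonal function of profile `p`. -/
noncomputable def zonalConv (p : Polynomial ℝ) (f : CSphere n → ℂ) (x : CSphere n) : ℂ :=
  ∫ y, zonalFun p x y * f y ∂(nu n)

theorem fourierCoeff_zonalFun (p : Polynomial ℝ) (f : CSphere n → ℂ) (x : CSphere n) :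
    fourierCoeff f (zonalFun p x) = zonalConv p f x := by
  simp [fourierCoeff, zonalConv, zonalFun, mul_comm]

theorem integrable_zonalFun_mul (p : Polynomial ℝ) {f : CSphere n → ℂ} (hf : Integrable f (nu n))
    (x : CSphere n) : Integrable (fun y => zonalFun p x y * f y) (nu n) := by
  obtain ⟨C, -, hC⟩ := exists_zonalFun_bound (n := n) p
  exact hf.bdd_mul (continuous_zonalFun_right p x).aestronglyMeasurable
    (Filter.Eventually.of_forall fun y => hC x y)

theorem zonalFun_zonal_zero (x y : CSphere n) : zonalFun (zonal n 0) x y = 1 := by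
  simp [zonalFun, zonal_zero]

theorem continuous_zonalConv (p : Polynomial ℝ) {f : CSphere n → ℂ} (hf : Integrable f (nu n)) :
    Continuous (zonalConv p f) := by
  obtain ⟨C, -, hC⟩ := exists_zonalFun_bound (n := n) p
  refine continuous_of_dominated (F := fun x y => zonalFun p x y * f y)
    (bound := fun y => C * ‖f y‖) (fun x => (integrable_zonalFun_mul p hf x).aestronglyMeasurable)
    (fun x => Filter.Eventually.of_forall fun y => ?_) (hf.norm.const_mul C)
    (Filter.Eventually.of_forall fun y => ?_)
  · rw [norm_mul]
    exact mul_le_mul_of_nonneg_right (hC x y) (norm_nonneg _)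
  · exact ((continuous_zonalFun p).comp (Continuous.prodMk_left y)).mul continuous_const

theorem zonalConv_cesaro (M : ℕ) {f : CSphere n → ℂ} (hf : Integrable f (nu n)) (x : CSphere n) :
    zonalConv (cesaro n M) f x = ∑ j ∈ Finset.range (M + 1),
      ((2 * n - 1 + (M - j)).choose (2 * n - 1) : ℂ) * zonalConv (zonal n j) f x := by
  have h1 : ∀ y, zonalFun (cesaro n M) x y * f y = ∑ j ∈ Finset.range (M + 1),
      ((2 * n - 1 + (M - j)).choose (2 * n - 1) : ℂ) * (zonalFun (zonal n j) x y * f y) :=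
    fun y => by
      simp only [zonalFun, cesaro, Polynomial.eval_finsetSum, Polynomial.eval_mul,
        Polynomial.eval_natCast]
      push_cast
      rw [Finset.sum_mul]
      exact Finset.sum_congr rfl fun j _ => by ring
  simp only [zonalConv, h1]
  rw [integral_finsetSum _ fun j _ => (integrable_zonalFun_mul _ hf x).const_mul _]
  simp only [integral_const_mul]

variable [NeZero n]

theorem one_le_of_neZero (n : ℕ) [NeZero n] : 1 ≤ n := Nat.one_le_iff_ne_zero.2 (NeZero.ne n)

theorem zonalConv_zonal_mem (j : ℕ) {f : CSphere n → ℂ} (hf : Integrable f (nu n)) :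
    zonalConv (zonal n j) f ∈ eigenspace n j := by
  have hW := finiteDimensional_span_zonalFun (n := n) (zonal n j)
  have h1 := integral_kernel_mem (μ := nu n)
    (Submodule.span ℂ (Set.range fun y : CSphere n => zonalFun (zonal n j) y))
    (zonalFun (zonal n j)) (fun y => Submodule.subset_span
      ⟨y, funext fun x => zonalFun_comm _ y x⟩) f (integrable_zonalFun_mul _ hf)
  refine Submodule.span_le.2 ?_ h1
  rintro _ ⟨y, rfl⟩
  exact zonalFun_zonal_mem_eigenspace (one_le_of_neZero n) j y

theorem integral_zonalFun_mul_zonalFun_of_ne {i j : ℕ} (hij : i ≠ j) (x z : CSphere n) :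
    ∫ y, zonalFun (zonal n i) x y * zonalFun (zonal n j) z y ∂(nu n) = 0 :=
  integral_mul_eq_zero_of_mem_eigenspace hij
    (zonalFun_zonal_mem_eigenspace (one_le_of_neZero n) i x)
    (zonalFun_zonal_mem_eigenspace (one_le_of_neZero n) j z)

/-- The first moments of the zonal harmonics. -/
theorem integral_zonalFun_mul_inner (j : ℕ) (x : CSphere n) :
    ∫ y, zonalFun (zonal n j) x y *
      ((inner ℝ (x : EuclideanSpace ℂ (Fin n)) (y : EuclideanSpace ℂ (Fin n)) : ℝ) : ℂ) ∂(nu n) =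
      if j = 1 then 1 else 0 := by
  have hn : (n : ℂ) ≠ 0 := by exact_mod_cast NeZero.ne n
  have h1 : ∀ y : CSphere n,
      ((inner ℝ (x : EuclideanSpace ℂ (Fin n)) (y : EuclideanSpace ℂ (Fin n)) : ℝ) : ℂ) =
      (2 * (n : ℂ))⁻¹ * zonalFun (zonal n 1) x y := fun y => by
    simp only [zonalFun, zonal_one, Polynomial.eval_mul, Polynomial.eval_ofNat,
      Polynomial.eval_natCast, Polynomial.eval_X]
    push_cast
    field_simp
  split_ifs with hj
  · subst hj
    -- Z_2 = (n + 1)(Z_1 t - 1), so orthogonality of Z_2 to constants gives the moment ∫ Z_1 t = 1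
    -- with no explicit integration.
    have h2 := integral_zonalFun_mul_zonalFun_of_ne (n := n) (show 2 ≠ 0 by norm_num) x x
    have h3 : ∀ y : CSphere n, zonalFun (zonal n 2) x y * zonalFun (zonal n 0) x y =
        ((n : ℂ) + 1) * (zonalFun (zonal n 1) x y * ((inner ℝ (x : EuclideanSpace ℂ (Fin n))
          (y : EuclideanSpace ℂ (Fin n)) : ℝ) : ℂ) - 1) := fun y => by
      rw [zonalFun_zonal_zero]
      simp only [zonalFun, zonal_one, zonal_two, Polynomial.eval_mul, Polynomial.eval_ofNat,
        Polynomial.eval_natCast, Polynomial.eval_X, Polynomial.eval_sub, Polynomial.eval_add,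
        Polynomial.eval_one, Polynomial.eval_pow]
      push_cast
      ring
    simp only [h3] at h2
    have hint : Integrable (fun y : CSphere n => zonalFun (zonal n 1) x y *
        ((inner ℝ (x : EuclideanSpace ℂ (Fin n)) (y : EuclideanSpace ℂ (Fin n)) : ℝ) : ℂ))
        (nu n) := by
      refine integrable_of_continuous ((continuous_zonalFun_right _ x).mul ?_)
      fun_prop
    rw [integral_const_mul, integral_sub hint (integrable_const _), mul_eq_zero,
      or_iff_right (by exact_mod_cast Nat.succ_ne_zero n), sub_eq_zero] at h2
    simpa using h2
  · simp only [h1]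
    have := integral_zonalFun_mul_zonalFun_of_ne (n := n) hj x x
    simp only [mul_left_comm _ (2 * (n : ℂ))⁻¹, integral_const_mul, this, mul_zero]

end Zonal

/-! ### Cesàro approximation and the reproducing property. -/

section Approximation

theorem tendsto_choose_ratio (d j : ℕ) :
    Filter.Tendsto (fun M : ℕ => ((d + (M - j)).choose d : ℝ) / ((d + M).choose d : ℝ))
      Filter.atTop (nhds 1) := by
  have hpos : ∀ m : ℕ, (0 : ℝ) < ((d + m).choose d : ℝ) := fun m => by
    exact_mod_cast Nat.choose_pos (Nat.le_add_right d m)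
  have hstep : Filter.Tendsto
      (fun m : ℕ => ((d + m).choose d : ℝ) / ((d + (m + 1)).choose d : ℝ))
      Filter.atTop (nhds 1) := by
    have h1 : ∀ m : ℕ, ((d + m).choose d : ℝ) / ((d + (m + 1)).choose d : ℝ) =
        1 - (d : ℝ) / (((m + 1 : ℕ) : ℝ) + d) := fun m => by
      have h2 := Nat.choose_mul_succ_eq (d + m) d
      rw [show d + m + 1 - d = m + 1 by omega] at h2
      have h3 : ((d + m).choose d : ℝ) * (d + m + 1) = ((d + (m + 1)).choose d : ℝ) * (m + 1) := by
        exact_mod_cast h2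
      rw [div_eq_iff (hpos _).ne']
      have h4 : ((m + 1 : ℕ) : ℝ) + d ≠ 0 := by positivity
      field_simp
      push_cast
      linear_combination h3
    simp only [h1]
    have h5 : Filter.Tendsto (fun m : ℕ => (d : ℝ) / (((m + 1 : ℕ) : ℝ) + d)) Filter.atTop
        (nhds 0) := by
      refine Filter.Tendsto.div_atTop tendsto_const_nhds ?_
      exact Filter.tendsto_atTop_add_const_right _ _
        (tendsto_natCast_atTop_atTop.comp (Filter.tendsto_add_atTop_nat 1))
    simpa using tendsto_const_nhds.sub h5
  rw [← Filter.tendsto_add_atTop_iff_nat j]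
  simp only [Nat.add_sub_cancel]
  induction j with
  | zero => simp [div_self (hpos _).ne']
  | succ j ih =>
    have h1 := ih.mul ((Filter.tendsto_add_atTop_iff_nat j).2 hstep)
    rw [one_mul] at h1
    refine h1.congr fun m => ?_
    rw [← add_assoc m, div_mul_div_cancel₀ (hpos _).ne']

variable {n : ℕ}

theorem dist_sq_eq_two_mul_one_sub_inner (x y : CSphere n) :
    dist x y ^ 2 = 2 * (1 - inner ℝ (x : EuclideanSpace ℂ (Fin n))
      (y : EuclideanSpace ℂ (Fin n))) := by
  rw [Subtype.dist_eq, dist_eq_norm, norm_sub_sq_real]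
  simp
  ring

variable [NeZero n]

/-- The total mass of the Cesàro kernel. -/
theorem integral_zonalFun_cesaro (M : ℕ) (x : CSphere n) :
    ∫ y, zonalFun (cesaro n M) x y ∂(nu n) = ((2 * n - 1 + M).choose (2 * n - 1) : ℂ) := by
  have h1 := zonalConv_cesaro (n := n) M (f := fun _ => 1) (integrable_const _) x
  simp only [zonalConv, mul_one] at h1
  rw [h1, Finset.sum_eq_single 0]
  · simp [zonalFun_zonal_zero]
  · intro j _ hj
    have := integral_zonalFun_mul_zonalFun_of_ne (n := n) hj x x
    simp only [zonalFun_zonal_zero, mul_one] at this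
    rw [this, mul_zero]
  · simp

/-- The first moment of the Cesàro kernel. -/
theorem integral_zonalFun_cesaro_mul_inner {M : ℕ} (hM : 1 ≤ M) (x : CSphere n) :
    ∫ y, zonalFun (cesaro n M) x y *
      ((inner ℝ (x : EuclideanSpace ℂ (Fin n)) (y : EuclideanSpace ℂ (Fin n)) : ℝ) : ℂ) ∂(nu n) =
      ((2 * n - 1 + (M - 1)).choose (2 * n - 1) : ℂ) := by
  have h1 := zonalConv_cesaro (n := n) M (f := fun y =>
    ((inner ℝ (x : EuclideanSpace ℂ (Fin n)) (y : EuclideanSpace ℂ (Fin n)) : ℝ) : ℂ))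
    (integrable_of_continuous (by fun_prop)) x
  simp only [zonalConv] at h1
  rw [h1, Finset.sum_eq_single 1]
  · rw [integral_zonalFun_mul_inner]; simp
  · intro j _ hj
    rw [integral_zonalFun_mul_inner, if_neg hj, mul_zero]
  · intro h
    exact absurd (Finset.mem_range.2 (by omega)) h

theorem norm_zonalFun_cesaro (M : ℕ) (x y : CSphere n) :
    ‖zonalFun (cesaro n M) x y‖ = (cesaro n M).eval
      (inner ℝ (x : EuclideanSpace ℂ (Fin n)) (y : EuclideanSpace ℂ (Fin n))) := by
  rw [zonalFun, Complex.norm_real, Real.norm_of_nonneg]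
  exact eval_cesaro_nonneg n M (one_le_of_neZero n) (abs_inner_le_one x y)

theorem integral_norm_zonalFun_cesaro (M : ℕ) (x : CSphere n) :
    ∫ y, ‖zonalFun (cesaro n M) x y‖ ∂(nu n) = ((2 * n - 1 + M).choose (2 * n - 1) : ℝ) := by
  have h := integral_zonalFun_cesaro (n := n) M x
  simp only [zonalFun, integral_complex_ofReal] at h
  simp only [norm_zonalFun_cesaro]
  exact_mod_cast h

theorem integral_norm_zonalFun_cesaro_mul_one_sub_inner {M : ℕ} (hM : 1 ≤ M) (x : CSphere n) :
    ∫ y, ‖zonalFun (cesaro n M) x y‖ *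
      (1 - inner ℝ (x : EuclideanSpace ℂ (Fin n)) (y : EuclideanSpace ℂ (Fin n))) ∂(nu n) =
      ((2 * n - 1 + M).choose (2 * n - 1) : ℝ) -
        ((2 * n - 1 + (M - 1)).choose (2 * n - 1) : ℝ) := by
  have h := integral_zonalFun_cesaro_mul_inner (n := n) hM x
  simp only [zonalFun, ← Complex.ofReal_mul, integral_complex_ofReal] at h
  have h' : ∫ y : CSphere n, (cesaro n M).eval
      (inner ℝ (x : EuclideanSpace ℂ (Fin n)) (y : EuclideanSpace ℂ (Fin n))) *
      inner ℝ (x : EuclideanSpace ℂ (Fin n)) (y : EuclideanSpace ℂ (Fin n)) ∂(nu n) =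
      ((2 * n - 1 + (M - 1)).choose (2 * n - 1) : ℝ) := by exact_mod_cast h
  have hc := continuous_zonalFun_right (cesaro n M) x
  have hc' : Continuous fun y : CSphere n =>
    inner ℝ (x : EuclideanSpace ℂ (Fin n)) (y : EuclideanSpace ℂ (Fin n)) := by fun_prop
  rw [← h', ← integral_norm_zonalFun_cesaro M x]
  simp only [← norm_zonalFun_cesaro]
  rw [← integral_sub (integrable_of_continuous hc.norm)
    (integrable_of_continuous (f := fun y => ‖zonalFun (cesaro n M) x y‖ *
      inner ℝ (x : EuclideanSpace ℂ (Fin n)) (y : EuclideanSpace ℂ (Fin n))) (hc.norm.mul hc'))]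
  simp only [mul_sub, mul_one]

/-- The normalized Cesàro means of a continuous function converge uniformly. -/
theorem eventually_norm_zonalConv_cesaro_sub_le {φ : CSphere n → ℂ} (hφ : Continuous φ)
    {ε : ℝ} (hε : 0 < ε) : ∀ᶠ M : ℕ in Filter.atTop, ∀ x,
      ‖(((2 * n - 1 + M).choose (2 * n - 1) : ℝ) : ℂ)⁻¹ * zonalConv (cesaro n M) φ x - φ x‖ ≤ ε := by
  obtain ⟨B, hB⟩ := (isCompact_univ (X := CSphere n)).exists_bound_of_continuousOn hφ.continuousOn
  obtain ⟨δ, hδ, hu⟩ := Metric.uniformContinuous_iff.1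
    (CompactSpace.uniformContinuous_of_continuous hφ) (ε / 2) (by positivity)
  -- Korovkin argument: since dist² = 2(1 - t), points at distance at least δ satisfy K(1 - t) ≥
  -- 2(|B| + 1), which exceeds the oscillation of φ. Averaging against the positive kernel then
  -- needs only its mass and first moment.
  set K : ℝ := 4 * (|B| + 1) / δ ^ 2 with hK
  have hKpos : 0 < K := by positivity
  have hpt : ∀ x y, ‖φ y - φ x‖ ≤ ε / 2 + K * (1 - inner ℝ (x : EuclideanSpace ℂ (Fin n))
      (y : EuclideanSpace ℂ (Fin n))) := fun x y => by
    have hd := dist_sq_eq_two_mul_one_sub_inner x y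
    set s := 1 - inner ℝ (x : EuclideanSpace ℂ (Fin n)) (y : EuclideanSpace ℂ (Fin n))
    have hs : 0 ≤ s := by nlinarith [sq_nonneg (dist x y)]
    by_cases hxy : dist y x < δ
    · have := hu hxy
      rw [dist_eq_norm] at this
      nlinarith
    · have h1 : δ ^ 2 ≤ 2 * s := by
        rw [← hd, dist_comm]
        exact pow_le_pow_left₀ hδ.le (not_lt.1 hxy) 2
      have h2 : ‖φ y - φ x‖ ≤ 2 * (|B| + 1) := by
        refine (norm_sub_le _ _).trans ?_
        have := hB x trivial
        have := hB y trivial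
        have := le_abs_self B
        linarith
      have h3 : 2 * (|B| + 1) ≤ K * s := by
        rw [hK, div_mul_eq_mul_div, le_div_iff₀ (by positivity)]
        nlinarith [abs_nonneg B]
      linarith
  have hlim := (tendsto_choose_ratio (2 * n - 1) 1)
  have hlim' : Filter.Tendsto (fun M : ℕ => K * (1 - ((2 * n - 1 + (M - 1)).choose (2 * n - 1) : ℝ) /
      ((2 * n - 1 + M).choose (2 * n - 1) : ℝ))) Filter.atTop (nhds 0) := by
    simpa using ((tendsto_const_nhds (x := (1 : ℝ))).sub hlim).const_mul K
  filter_upwards [hlim'.eventually (gt_mem_nhds (show (0 : ℝ) < ε / 2 by positivity)),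
    Filter.eventually_ge_atTop 1] with M hM hM1 x
  set A : ℝ := ((2 * n - 1 + M).choose (2 * n - 1) : ℝ) with hA
  have hApos : 0 < A := by
    rw [hA]; exact_mod_cast Nat.choose_pos (Nat.le_add_right _ M)
  have hc := continuous_zonalFun_right (cesaro n M) x
  have hc' : Continuous fun y : CSphere n =>
    inner ℝ (x : EuclideanSpace ℂ (Fin n)) (y : EuclideanSpace ℂ (Fin n)) := by fun_prop
  have hAc : (A : ℂ) ≠ 0 := by exact_mod_cast hApos.ne'
  have h1 : (A : ℂ)⁻¹ * zonalConv (cesaro n M) φ x - φ x =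
      (A : ℂ)⁻¹ * ∫ y, zonalFun (cesaro n M) x y * (φ y - φ x) ∂(nu n) := by
    have h2 : ∫ y, zonalFun (cesaro n M) x y * (φ y - φ x) ∂(nu n) =
        zonalConv (cesaro n M) φ x - (A : ℂ) * φ x := by
      simp only [mul_sub]
      rw [integral_sub
        (integrable_of_continuous (f := fun y => zonalFun (cesaro n M) x y * φ y) (hc.mul hφ))
        (integrable_of_continuous (f := fun y => zonalFun (cesaro n M) x y * φ x)
          (hc.mul continuous_const)), integral_mul_const, integral_zonalFun_cesaro]
      simp [zonalConv, hA]
    rw [h2]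
    field_simp
  rw [h1, norm_mul, norm_inv, Complex.norm_real, Real.norm_of_nonneg hApos.le,
    inv_mul_le_iff₀ hApos]
  calc ‖∫ y, zonalFun (cesaro n M) x y * (φ y - φ x) ∂(nu n)‖
      ≤ ∫ y, ‖zonalFun (cesaro n M) x y * (φ y - φ x)‖ ∂(nu n) := norm_integral_le_integral_norm _
    _ ≤ ∫ y, (ε / 2 * ‖zonalFun (cesaro n M) x y‖ + K * (‖zonalFun (cesaro n M) x y‖ *
          (1 - inner ℝ (x : EuclideanSpace ℂ (Fin n)) (y : EuclideanSpace ℂ (Fin n))))) ∂(nu n) := by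
        refine integral_mono (integrable_of_continuous (hc.mul (hφ.sub continuous_const)).norm)
          (integrable_of_continuous (by fun_prop)) fun y => ?_
        simp only [norm_mul]
        have := mul_le_mul_of_nonneg_left (hpt x y) (norm_nonneg (zonalFun (cesaro n M) x y))
        linarith
    _ = ε / 2 * A + K * (A - ((2 * n - 1 + (M - 1)).choose (2 * n - 1) : ℝ)) := by
        rw [integral_add (integrable_of_continuous (by fun_prop))
          (integrable_of_continuous (by fun_prop)), integral_const_mul, integral_const_mul,
          integral_norm_zonalFun_cesaro, integral_norm_zonalFun_cesaro_mul_one_sub_inner hM1]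
    _ ≤ A * ε := by
        have h3 : K * (A - ((2 * n - 1 + (M - 1)).choose (2 * n - 1) : ℝ)) ≤ A * (ε / 2) := by
          have h4 : K * (A - ((2 * n - 1 + (M - 1)).choose (2 * n - 1) : ℝ)) =
              A * (K * (1 - ((2 * n - 1 + (M - 1)).choose (2 * n - 1) : ℝ) / A)) := by
            field_simp
          rw [h4]
          exact mul_le_mul_of_nonneg_left hM.le hApos.le
        linarith

/-- The reproducing property of the zonal harmonics. -/
theorem integral_zonalFun_mul_zonalFun (i j : ℕ) (x z : CSphere n) :
    ∫ y, zonalFun (zonal n i) x y * zonalFun (zonal n j) y z ∂(nu n) =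
      if i = j then zonalFun (zonal n j) x z else 0 := by
  have hcomm : ∀ y : CSphere n, zonalFun (zonal n j) y z = zonalFun (zonal n j) z y :=
    fun y => zonalFun_comm _ y z
  simp only [hcomm]
  split_ifs with hij
  · subst hij
    have hcont := continuous_zonalFun_right (zonal n i) z
    -- The normalized Cesàro means of the zonal function have two limits: its value, by uniform
    -- convergence, and I, because only degree i contributes and its weight tends to 1.
    set I := ∫ y, zonalFun (zonal n i) x y * zonalFun (zonal n i) z y ∂(nu n) with hI
    have h1 : Filter.Tendsto (fun M : ℕ => (((2 * n - 1 + M).choose (2 * n - 1) : ℝ) : ℂ)⁻¹ *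
        zonalConv (cesaro n M) (zonalFun (zonal n i) z) x) Filter.atTop
        (nhds (zonalFun (zonal n i) z x)) := by
      rw [Metric.tendsto_nhds]
      intro ε hε
      filter_upwards [eventually_norm_zonalConv_cesaro_sub_le hcont (half_pos hε)] with M hM
      rw [dist_eq_norm]
      exact (hM x).trans_lt (half_lt_self hε)
    have h2 : Filter.Tendsto (fun M : ℕ => (((2 * n - 1 + M).choose (2 * n - 1) : ℝ) : ℂ)⁻¹ *
        zonalConv (cesaro n M) (zonalFun (zonal n i) z) x) Filter.atTop (nhds I) := by
      have h3 : Filter.Tendsto (fun M : ℕ => (((((2 * n - 1 + (M - i)).choose (2 * n - 1) : ℝ) /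
          ((2 * n - 1 + M).choose (2 * n - 1) : ℝ)) : ℝ) : ℂ) * I) Filter.atTop (nhds I) := by
        have := ((Complex.continuous_ofReal.tendsto 1).comp
          (tendsto_choose_ratio (2 * n - 1) i)).mul_const I
        simpa using this
      refine h3.congr' ?_
      filter_upwards [Filter.eventually_ge_atTop i] with M hM
      rw [zonalConv_cesaro M (integrable_of_continuous hcont), Finset.sum_eq_single i]
      · rw [zonalConv, ← hI]
        push_cast
        ring
      · intro k _ hk
        rw [zonalConv, integral_zonalFun_mul_zonalFun_of_ne hk, mul_zero]
      · intro h
        exact absurd (Finset.mem_range.2 (by omega)) h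
    exact tendsto_nhds_unique h2 h1
  · exact integral_zonalFun_mul_zonalFun_of_ne hij x z

/-- The projections onto the eigenspaces are orthogonal idempotents. -/
theorem zonalConv_zonal_zonalConv_zonal (i j : ℕ) {f : CSphere n → ℂ} (hf : Integrable f (nu n))
    (x : CSphere n) : zonalConv (zonal n i) (zonalConv (zonal n j) f) x =
      if i = j then zonalConv (zonal n j) f x else 0 := by
  have hint : Integrable (fun q : CSphere n × CSphere n =>
      zonalFun (zonal n i) x q.1 * (zonalFun (zonal n j) q.1 q.2 * f q.2))
      ((nu n).prod (nu n)) := by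
    obtain ⟨C, -, hC⟩ := exists_zonalFun_bound (n := n) (zonal n i)
    obtain ⟨C', -, hC'⟩ := exists_zonalFun_bound (n := n) (zonal n j)
    refine Integrable.bdd_mul (c := C) (Integrable.bdd_mul (c := C') (hf.comp_snd (nu n))
      (continuous_zonalFun _).aestronglyMeasurable
      (Filter.Eventually.of_forall fun q => hC' q.1 q.2))
      ((continuous_zonalFun_right _ x).comp continuous_fst).aestronglyMeasurable
      (Filter.Eventually.of_forall fun q => hC x q.1)
  calc zonalConv (zonal n i) (zonalConv (zonal n j) f) x
      = ∫ y, ∫ z, zonalFun (zonal n i) x y * (zonalFun (zonal n j) y z * f z) ∂(nu n) ∂(nu n) := by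
        simp only [zonalConv, integral_const_mul]
    _ = ∫ z, ∫ y, zonalFun (zonal n i) x y * (zonalFun (zonal n j) y z * f z) ∂(nu n) ∂(nu n) :=
        integral_integral_swap hint
    _ = ∫ z, (if i = j then zonalFun (zonal n j) x z else 0) * f z ∂(nu n) := by
        simp only [← mul_assoc, integral_mul_const, integral_zonalFun_mul_zonalFun]
    _ = _ := by
        split_ifs <;> simp [zonalConv]

end Approximation

/-! ### L_p bounds for Cesàro means and completeness. -/

section LpBound

variable {n : ℕ} [NeZero n]

theorem lintegral_enorm_zonalFun_cesaro (M : ℕ) (x : CSphere n) :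
    ∫⁻ y, ‖zonalFun (cesaro n M) x y‖ₑ ∂(nu n) = ((2 * n - 1 + M).choose (2 * n - 1) : ℝ≥0∞) := by
  rw [← ofReal_integral_norm_eq_lintegral_enorm
    (integrable_of_continuous (continuous_zonalFun_right _ x)), integral_norm_zonalFun_cesaro,
    ENNReal.ofReal_natCast]

theorem enorm_zonalConv_cesaro_le (M : ℕ) {p : ℝ≥0∞} (hp : 1 ≤ p) {g : CSphere n → ℂ}
    (hg : AEStronglyMeasurable g (nu n)) (x : CSphere n) :
    ‖zonalConv (cesaro n M) g x‖ₑ ≤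
      eLpNorm g p ((nu n).withDensity fun y => ‖zonalFun (cesaro n M) x y‖ₑ) *
        ((2 * n - 1 + M).choose (2 * n - 1) : ℝ≥0∞) ^ (1 - 1 / p.toReal) := by
  set k : CSphere n → ℝ≥0∞ := fun y => ‖zonalFun (cesaro n M) x y‖ₑ with hk
  have hkm : Measurable k := (continuous_zonalFun_right _ x).measurable.enorm
  have huniv : (nu n).withDensity k Set.univ = ((2 * n - 1 + M).choose (2 * n - 1) : ℝ≥0∞) := by
    rw [withDensity_apply _ MeasurableSet.univ, Measure.restrict_univ,
      lintegral_enorm_zonalFun_cesaro]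
  have hg' : AEStronglyMeasurable g ((nu n).withDensity k) :=
    hg.mono_ac (withDensity_absolutelyContinuous _ _)
  calc ‖zonalConv (cesaro n M) g x‖ₑ
      ≤ ∫⁻ y, ‖zonalFun (cesaro n M) x y * g y‖ₑ ∂(nu n) := enorm_integral_le_lintegral_enorm _
    _ = ∫⁻ y, (k * fun y => ‖g y‖ₑ) y ∂(nu n) := by simp only [enorm_mul, Pi.mul_apply, hk]
    _ = eLpNorm g 1 ((nu n).withDensity k) := by
        rw [eLpNorm_one_eq_lintegral_enorm,
          lintegral_withDensity_eq_lintegral_mul₀ hkm.aemeasurable hg.enorm]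
    _ ≤ eLpNorm g p ((nu n).withDensity k) *
          (nu n).withDensity k Set.univ ^ (1 / (1 : ℝ≥0∞).toReal - 1 / p.toReal) :=
        -- Hölder's inequality for the kernel taken as a measure of total mass C(d+M, d).
        eLpNorm_le_eLpNorm_mul_rpow_measure_univ hp hg'
    _ = _ := by rw [huniv]; simp

/-- Convolution with a Cesàro kernel is bounded on every `L_p` by the mass of the kernel. -/
theorem eLpNorm_zonalConv_cesaro_le (M : ℕ) {p : ℝ≥0∞} (hp : 1 ≤ p) {g : CSphere n → ℂ}
    (hg : AEStronglyMeasurable g (nu n)) :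
    eLpNorm (zonalConv (cesaro n M) g) p (nu n) ≤
      ((2 * n - 1 + M).choose (2 * n - 1) : ℝ≥0∞) * eLpNorm g p (nu n) := by
  set A : ℝ≥0∞ := ((2 * n - 1 + M).choose (2 * n - 1) : ℝ≥0∞) with hA
  have hA0 : A ≠ 0 := by
    rw [hA]; exact_mod_cast (Nat.choose_pos (Nat.le_add_right _ M)).ne'
  have hAt : A ≠ ⊤ := ENNReal.natCast_ne_top _
  have hpt := fun x => enorm_zonalConv_cesaro_le M hp hg x
  by_cases hptop : p = ⊤
  · subst hptop
    rw [eLpNorm_exponent_top]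
    refine eLpNormEssSup_le_of_ae_enorm_bound (Filter.Eventually.of_forall fun x => ?_)
    refine (hpt x).trans ?_
    rw [mul_comm]
    refine mul_le_mul' (by simp [hA]) ?_
    rw [eLpNorm_exponent_top]
    exact eLpNormEssSup_mono_measure _ (withDensity_absolutelyContinuous _ _)
  have hp0 : p ≠ 0 := (zero_lt_one.trans_le hp).ne'
  set q := p.toReal with hq
  have hq1 : 1 ≤ q := by
    rw [hq, ← ENNReal.toReal_one]
    exact ENNReal.toReal_mono hptop hp
  have hq0 : 0 < q := by linarith
  have hk : Measurable (Function.uncurry fun x y : CSphere n => ‖zonalFun (cesaro n M) x y‖ₑ) :=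
    (continuous_zonalFun (cesaro n M)).measurable.enorm
  have hpt2 : ∀ x, ‖zonalConv (cesaro n M) g x‖ₑ ^ q ≤
      A ^ (q - 1) * ∫⁻ y, ‖zonalFun (cesaro n M) x y‖ₑ * ‖g y‖ₑ ^ q ∂(nu n) := fun x => by
    refine (ENNReal.rpow_le_rpow (hpt x) hq0.le).trans_eq ?_
    rw [ENNReal.mul_rpow_of_nonneg _ _ hq0.le, ← ENNReal.rpow_mul,
      eLpNorm_eq_lintegral_rpow_enorm_toReal hp0 hptop, ← ENNReal.rpow_mul, ← hq,
      one_div_mul_cancel hq0.ne', ENNReal.rpow_one, mul_comm,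
      show (1 - 1 / q) * q = q - 1 by field_simp,
      lintegral_withDensity_eq_lintegral_mul₀
        (continuous_zonalFun_right _ x).measurable.enorm.aemeasurable (hg.enorm.pow_const q)]
    rfl
  -- Schur test: after Tonelli, symmetry of the kernel supplies the remaining factor A from
  -- integration in x.
  have hint : ∫⁻ x, ‖zonalConv (cesaro n M) g x‖ₑ ^ q ∂(nu n) ≤
      A ^ q * ∫⁻ y, ‖g y‖ₑ ^ q ∂(nu n) := by
    calc ∫⁻ x, ‖zonalConv (cesaro n M) g x‖ₑ ^ q ∂(nu n)
        ≤ ∫⁻ x, A ^ (q - 1) * ∫⁻ y, ‖zonalFun (cesaro n M) x y‖ₑ * ‖g y‖ₑ ^ q ∂(nu n) ∂(nu n) :=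
          lintegral_mono hpt2
      _ = A ^ (q - 1) *
          ∫⁻ x, ∫⁻ y, ‖zonalFun (cesaro n M) x y‖ₑ * ‖g y‖ₑ ^ q ∂(nu n) ∂(nu n) :=
          lintegral_const_mul' _ _ (ENNReal.rpow_ne_top_of_nonneg (by linarith) hAt)
      _ = A ^ (q - 1) *
          ∫⁻ y, ∫⁻ x, ‖zonalFun (cesaro n M) x y‖ₑ * ‖g y‖ₑ ^ q ∂(nu n) ∂(nu n) := by
          rw [lintegral_lintegral_swap]
          exact hk.aemeasurable.mul ((hg.enorm.pow_const q).comp_snd)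
      _ = A ^ (q - 1) * ∫⁻ y, A * ‖g y‖ₑ ^ q ∂(nu n) := by
          congr 1
          refine lintegral_congr fun y => ?_
          simp only [zonalFun_comm _ _ y]
          rw [lintegral_mul_const _ (continuous_zonalFun_right _ y).measurable.enorm,
            lintegral_enorm_zonalFun_cesaro]
      _ = A ^ q * ∫⁻ y, ‖g y‖ₑ ^ q ∂(nu n) := by
          rw [lintegral_const_mul' _ _ hAt, ← mul_assoc]
          congr 1
          nth_rewrite 2 [← ENNReal.rpow_one A]
          rw [← ENNReal.rpow_add _ _ hA0 hAt, sub_add_cancel]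
  rw [eLpNorm_eq_lintegral_rpow_enorm_toReal hp0 hptop,
    eLpNorm_eq_lintegral_rpow_enorm_toReal hp0 hptop, ← hq]
  refine (ENNReal.rpow_le_rpow hint (by positivity)).trans_eq ?_
  rw [ENNReal.mul_rpow_of_nonneg _ _ (by positivity), ← ENNReal.rpow_mul,
    mul_one_div_cancel hq0.ne', ENNReal.rpow_one]

theorem integral_norm_zonalConv_cesaro_le (M : ℕ) {g : CSphere n → ℂ} (hg : Integrable g (nu n)) :
    ∫ x, ‖zonalConv (cesaro n M) g x‖ ∂(nu n) ≤
      ((2 * n - 1 + M).choose (2 * n - 1) : ℝ) * ∫ x, ‖g x‖ ∂(nu n) := by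
  have h := eLpNorm_zonalConv_cesaro_le M le_rfl hg.aestronglyMeasurable
  have hc : Integrable (zonalConv (cesaro n M) g) (nu n) :=
    integrable_of_continuous (continuous_zonalConv _ hg)
  rw [eLpNorm_one_eq_lintegral_enorm, eLpNorm_one_eq_lintegral_enorm,
    ← ofReal_integral_norm_eq_lintegral_enorm hg, ← ofReal_integral_norm_eq_lintegral_enorm hc,
    ← ENNReal.ofReal_natCast, ← ENNReal.ofReal_mul (Nat.cast_nonneg _),
    ENNReal.ofReal_le_ofReal_iff (mul_nonneg (Nat.cast_nonneg _)
      (integral_nonneg fun _ => norm_nonneg _))] at h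
  exact h

/-- An integrable function without harmonic components of degree above `N` is the sum of its
components of degree at most `N`. -/
theorem ae_eq_sum_zonalConv {h : CSphere n → ℂ} (hh : Integrable h (nu n)) (N : ℕ)
    (hN : ∀ j, N < j → ∀ x, zonalConv (zonal n j) h x = 0) :
    h =ᵐ[nu n] ∑ j ∈ Finset.range (N + 1), zonalConv (zonal n j) h := by
  set q : CSphere n → ℂ := ∑ j ∈ Finset.range (N + 1), zonalConv (zonal n j) h with hq
  have hcq : ∀ j, Continuous (zonalConv (zonal n j) h) := fun j => continuous_zonalConv _ hh
  have hqc : Continuous q := by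
    rw [hq]
    simpa only [Finset.sum_fn] using continuous_finsetSum _ fun j _ => hcq j
  have hqi : Integrable q (nu n) := integrable_of_continuous hqc
  set A : ℕ → ℝ := fun M => ((2 * n - 1 + M).choose (2 * n - 1) : ℝ) with hA
  have hApos : ∀ M, 0 < A M := fun M => by
    simp only [hA]; exact_mod_cast Nat.choose_pos (Nat.le_add_right _ M)
  set B : ℕ → ℝ := fun j => ∫ x, ‖zonalConv (zonal n j) h x‖ ∂(nu n) with hB
  have hσ : ∀ M, N ≤ M → ∫ x, ‖(A M : ℂ)⁻¹ * zonalConv (cesaro n M) h x - q x‖ ∂(nu n) ≤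
      ∑ j ∈ Finset.range (N + 1), |A (M - j) / A M - 1| * B j := by
    intro M hM
    have h1 : ∀ x, (A M : ℂ)⁻¹ * zonalConv (cesaro n M) h x - q x =
        ∑ j ∈ Finset.range (N + 1), ((A (M - j) / A M - 1 : ℝ) : ℂ) * zonalConv (zonal n j) h x := by
      intro x
      have h2 : ∑ j ∈ Finset.range (N + 1), ((A (M - j) : ℝ) : ℂ) * zonalConv (zonal n j) h x =
          zonalConv (cesaro n M) h x := by
        rw [zonalConv_cesaro M hh]
        refine Finset.sum_subset (Finset.range_mono (by omega)) fun j _ hj => ?_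
        rw [hN j (by simpa using hj), mul_zero]
      rw [← h2, hq, Finset.sum_apply, Finset.mul_sum, ← Finset.sum_sub_distrib]
      refine Finset.sum_congr rfl fun j _ => ?_
      push_cast
      ring
    simp only [h1]
    calc _ ≤ ∫ x, ∑ j ∈ Finset.range (N + 1),
          |A (M - j) / A M - 1| * ‖zonalConv (zonal n j) h x‖ ∂(nu n) := by
          refine integral_mono (integrable_of_continuous ?_) (integrable_of_continuous ?_)
            fun x => ?_
          · exact (continuous_finsetSum _ fun j _ => continuous_const.mul (hcq j)).norm
          · exact continuous_finsetSum _ fun j _ => continuous_const.mul (hcq j).norm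
          · refine (norm_sum_le _ _).trans_eq (Finset.sum_congr rfl fun j _ => ?_)
            rw [norm_mul, Complex.norm_real, Real.norm_eq_abs]
      _ = _ := by
          rw [integral_finsetSum _ fun j _ => integrable_of_continuous
            (f := fun x => |A (M - j) / A M - 1| * ‖zonalConv (zonal n j) h x‖)
            (continuous_const.mul (hcq j).norm)]
          simp only [integral_const_mul, hB]
  have hlim : Filter.Tendsto (fun M => ∑ j ∈ Finset.range (N + 1), |A (M - j) / A M - 1| * B j)
      Filter.atTop (nhds 0) := by
    have : Filter.Tendsto (fun M => ∑ j ∈ Finset.range (N + 1), |A (M - j) / A M - 1| * B j)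
        Filter.atTop (nhds (∑ j ∈ Finset.range (N + 1), |(1 : ℝ) - 1| * B j)) :=
      tendsto_finsetSum _ fun j _ =>
        (((tendsto_choose_ratio (2 * n - 1) j).sub_const 1).abs).mul_const (B j)
    simpa using this
  -- With φ continuous and close to h in L_1, and s the normalized Cesàro mean, pass along h, φ, sφ,
  -- sh, q; each of the four steps costs at most ε.
  have hsmall : ∀ ε : ℝ, 0 < ε → ∫ x, ‖h x - q x‖ ∂(nu n) ≤ 4 * ε := by
    intro ε hε
    obtain ⟨φ, hφ, hφi⟩ := hh.exists_boundedContinuous_integral_sub_le hε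
    have hφc : Continuous φ := φ.continuous
    obtain ⟨M, hM1, hM2, hM3⟩ := ((eventually_norm_zonalConv_cesaro_sub_le hφc hε).and
      ((hlim.eventually (gt_mem_nhds hε)).and (Filter.eventually_ge_atTop N))).exists
    set s : (CSphere n → ℂ) → CSphere n → ℂ := fun f x => (A M : ℂ)⁻¹ * zonalConv (cesaro n M) f x
      with hs
    have hsc : ∀ {f : CSphere n → ℂ}, Integrable f (nu n) → Continuous (s f) := fun hf =>
      continuous_const.mul (continuous_zonalConv _ hf)
    have hdi : Integrable (fun x => φ x - h x) (nu n) := hφi.sub hh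
    have e3 : ∀ x, s (fun x => φ x - h x) x = s φ x - s h x := fun x => by
      simp only [hs, zonalConv, mul_sub]
      rw [integral_sub (integrable_zonalFun_mul _ hφi x) (integrable_zonalFun_mul _ hh x), mul_sub]
    have b2 : ∫ x, ‖s φ x - φ x‖ ∂(nu n) ≤ ε := by
      have := integral_mono (μ := nu n) (integrable_of_continuous (((hsc hφi).sub hφc).norm))
        (integrable_const ε) (fun x => hM1 x)
      simpa using this
    have b3 : ∫ x, ‖s φ x - s h x‖ ∂(nu n) ≤ ε := by
      simp only [← e3]
      have h1 := integral_norm_zonalConv_cesaro_le M hdi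
      simp only [hs, norm_mul, norm_inv, Complex.norm_real, Real.norm_of_nonneg (hApos M).le,
        integral_const_mul]
      rw [inv_mul_le_iff₀ (hApos M)]
      refine h1.trans (mul_le_mul_of_nonneg_left ?_ (hApos M).le)
      simpa only [norm_sub_rev] using hφ
    have b4 : ∫ x, ‖s h x - q x‖ ∂(nu n) ≤ ε := (hσ M hM3).trans hM2.le
    have i1 : Integrable (fun x => ‖h x - φ x‖) (nu n) := (hh.sub hφi).norm
    have i2 : Integrable (fun x => ‖s φ x - φ x‖) (nu n) :=
      integrable_of_continuous ((hsc hφi).sub hφc).norm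
    have i3 : Integrable (fun x => ‖s φ x - s h x‖) (nu n) :=
      integrable_of_continuous ((hsc hφi).sub (hsc hh)).norm
    have i4 : Integrable (fun x => ‖s h x - q x‖) (nu n) :=
      integrable_of_continuous ((hsc hh).sub hqc).norm
    calc ∫ x, ‖h x - q x‖ ∂(nu n)
        ≤ ∫ x, (‖h x - φ x‖ + ‖s φ x - φ x‖ + ‖s φ x - s h x‖ + ‖s h x - q x‖) ∂(nu n) := by
          refine integral_mono (hh.sub hqi).norm (((i1.add i2).add i3).add i4) fun x => ?_
          have h1 : h x - q x = (h x - φ x) - (s φ x - φ x) + (s φ x - s h x) + (s h x - q x) := by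
            ring
          simp only [h1]
          refine (norm_add_le _ _).trans (add_le_add_left ((norm_add_le _ _).trans
            (add_le_add_left (norm_sub_le _ _) _)) _)
      _ = ∫ x, ‖h x - φ x‖ ∂(nu n) + ∫ x, ‖s φ x - φ x‖ ∂(nu n) + ∫ x, ‖s φ x - s h x‖ ∂(nu n) +
          ∫ x, ‖s h x - q x‖ ∂(nu n) := by
          have i12 : Integrable (fun x => ‖h x - φ x‖ + ‖s φ x - φ x‖) (nu n) := i1.add i2
          have i123 : Integrable (fun x => ‖h x - φ x‖ + ‖s φ x - φ x‖ + ‖s φ x - s h x‖) (nu n) :=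
            i12.add i3
          rw [integral_add i123 i4, integral_add i12 i3, integral_add i1 i2]
      _ ≤ 4 * ε := by linarith
  have hzero : ∫ x, ‖h x - q x‖ ∂(nu n) = 0 := by
    refine le_antisymm (le_of_forall_pos_le_add fun ε hε => ?_)
      (integral_nonneg fun _ => norm_nonneg _)
    have := hsmall (ε / 4) (by positivity)
    linarith
  have hzero' := (integral_eq_zero_iff_of_nonneg (fun _ => norm_nonneg _) (hh.sub hqi).norm).1 hzero
  filter_upwards [hzero'] with x hx
  exact sub_eq_zero.1 (norm_eq_zero.1 hx)

end LpBound

/-! ### The inverse operator on high degrees and the final estimate. -/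

section Favard

theorem ae_summable_of_summable_integral_norm {α : Type*} [MeasurableSpace α] {μ : Measure α}
    {F : ℕ → α → ℂ} (hF : ∀ i, Integrable (F i) μ) (hs : Summable fun i => ∫ a, ‖F i a‖ ∂μ) :
    ∀ᵐ a ∂μ, Summable fun i => F i a := by
  have h1 : ∫⁻ a, ∑' i, ‖F i a‖ₑ ∂μ ≠ ⊤ := by
    rw [lintegral_tsum fun i => (hF i).1.enorm]
    simp only [← ofReal_integral_norm_eq_lintegral_enorm (hF _)]
    rw [← ENNReal.ofReal_tsum_of_nonneg (fun i => integral_nonneg fun _ => norm_nonneg _) hs]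
    exact ENNReal.ofReal_ne_top
  have hm : AEMeasurable (fun a => ∑' i, ‖F i a‖ₑ) μ :=
    AEMeasurable.tsum fun i => (hF i).1.enorm
  filter_upwards [ae_lt_top' hm h1] with a ha
  have h2 : Summable fun i => ‖F i a‖₊ := by
    rw [← ENNReal.tsum_coe_ne_top_iff_summable]
    exact ha.ne
  exact Summable.of_norm (NNReal.summable_coe.2 h2)

variable {n : ℕ}

theorem zonalConv_sub (p : Polynomial ℝ) {f g : CSphere n → ℂ} (hf : Integrable f (nu n))
    (hg : Integrable g (nu n)) (x : CSphere n) :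
    zonalConv p (f - g) x = zonalConv p f x - zonalConv p g x := by
  simp only [zonalConv, Pi.sub_apply, mul_sub]
  exact integral_sub (integrable_zonalFun_mul _ hf x) (integrable_zonalFun_mul _ hg x)

variable [NeZero n]

/-- Orthogonality gives this on each eigenspace, and both properties are linear. Hence subtracting t
leaves the components outside K unchanged. -/
theorem continuous_of_mem_harmonicSpan {K : Finset ℕ} {t : CSphere n → ℂ}
    (ht : t ∈ harmonicSpan n K) :
    Continuous t ∧ ∀ j, j ∉ K → ∀ x, zonalConv (zonal n j) t x = 0 := by
  let S : Submodule ℂ (CSphere n → ℂ) :=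
    { carrier := {t | Continuous t ∧ ∀ j, j ∉ K → ∀ x, zonalConv (zonal n j) t x = 0}
      zero_mem' := ⟨continuous_zero, fun j _ x => by simp [zonalConv]⟩
      add_mem' := fun {u v} hu hv => ⟨hu.1.add hv.1, fun j hj x => by
        have h1 := hu.2 j hj x
        have h2 := hv.2 j hj x
        simp only [zonalConv] at h1 h2
        simp only [zonalConv, Pi.add_apply, mul_add]
        rw [integral_add (integrable_zonalFun_mul _ (integrable_of_continuous hu.1) x)
          (integrable_zonalFun_mul _ (integrable_of_continuous hv.1) x), h1, h2, add_zero]⟩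
      smul_mem' := fun c u hu => ⟨hu.1.const_smul c, fun j hj x => by
        have h1 := hu.2 j hj x
        simp only [zonalConv] at h1
        simp only [zonalConv, Pi.smul_apply, smul_eq_mul, mul_left_comm _ c, integral_const_mul,
          h1, mul_zero]⟩ }
  have hle : harmonicSpan n K ≤ S := by
    refine iSup₂_le fun k hk u hu => ⟨hu.1.continuous, fun j hj x => ?_⟩
    exact integral_mul_eq_zero_of_mem_eigenspace (by rintro rfl; exact hj hk)
      (zonalFun_zonal_mem_eigenspace (one_le_of_neZero n) j x) hu
  exact hle ht

theorem zonalConv_zonal_zonalConv_cesaro (j M : ℕ) {f : CSphere n → ℂ} (hf : Integrable f (nu n))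
    (x : CSphere n) : zonalConv (zonal n j) (zonalConv (cesaro n M) f) x =
      (if j ≤ M then ((2 * n - 1 + (M - j)).choose (2 * n - 1) : ℂ) else 0) *
        zonalConv (zonal n j) f x := by
  have hc : ∀ i, Integrable (zonalConv (zonal n i) f) (nu n) := fun i =>
    integrable_of_continuous (continuous_zonalConv _ hf)
  have h1 : zonalConv (zonal n j) (zonalConv (cesaro n M) f) x = ∑ i ∈ Finset.range (M + 1),
      ((2 * n - 1 + (M - i)).choose (2 * n - 1) : ℂ) *
        zonalConv (zonal n j) (zonalConv (zonal n i) f) x := by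
    have h2 : ∀ y, zonalFun (zonal n j) x y * zonalConv (cesaro n M) f y =
        ∑ i ∈ Finset.range (M + 1), ((2 * n - 1 + (M - i)).choose (2 * n - 1) : ℂ) *
          (zonalFun (zonal n j) x y * zonalConv (zonal n i) f y) := fun y => by
      rw [zonalConv_cesaro M hf, Finset.mul_sum]
      exact Finset.sum_congr rfl fun i _ => by ring
    rw [zonalConv]
    simp only [h2]
    rw [integral_finsetSum _ fun i _ => (integrable_zonalFun_mul _ (hc i) x).const_mul _]
    simp only [integral_const_mul]
    rfl
  rw [h1]
  simp only [zonalConv_zonal_zonalConv_zonal _ _ hf, mul_ite, mul_zero]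
  rw [Finset.sum_ite_eq]
  simp only [Finset.mem_range, Nat.lt_succ_iff]
  split_ifs <;> simp

/-- A nonnegative combination `F` of Cesàro means of `g`: its `L_p` norm and its harmonic
components. -/
theorem exists_cesaro_series {b : ℕ → ℝ} (hb : ∀ k, 0 ≤ b k) (m : ℕ)
    (hs : Summable fun i => ((2 * n - 1 + (m + i)).choose (2 * n - 1) : ℝ) * b (m + i))
    {p : ℝ≥0∞} (hp : 1 ≤ p) {g : CSphere n → ℂ} (hg : MemLp g p (nu n)) :
    ∃ F : CSphere n → ℂ, MemLp F p (nu n) ∧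
      eLpNorm F p (nu n) ≤
        ENNReal.ofReal (∑' i, ((2 * n - 1 + (m + i)).choose (2 * n - 1) : ℝ) * b (m + i)) *
          eLpNorm g p (nu n) ∧
      ∀ j x, HasSum (fun i => (if j ≤ m + i then
        ((2 * n - 1 + (m + i - j)).choose (2 * n - 1) : ℂ) * (b (m + i) : ℂ) else 0) *
          zonalConv (zonal n j) g x) (zonalConv (zonal n j) F x) := by
  have hgi : Integrable g (nu n) := hg.integrable hp
  -- Convergence is obtained in L_1, which contains L_p because the measure is finite; it gives the
  -- pointwise sum and termwise integration for every p, including ∞.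
  set G : ℕ → CSphere n → ℂ := fun i x => (b (m + i) : ℂ) * zonalConv (cesaro n (m + i)) g x with hG
  have hGc : ∀ i, Continuous (G i) := fun i => continuous_const.mul (continuous_zonalConv _ hgi)
  have hGi : ∀ i, Integrable (G i) (nu n) := fun i => integrable_of_continuous (hGc i)
  have hGn : ∀ i, ∫ x, ‖G i x‖ ∂(nu n) ≤
      ((2 * n - 1 + (m + i)).choose (2 * n - 1) : ℝ) * b (m + i) * ∫ x, ‖g x‖ ∂(nu n) := by
    intro i
    simp only [hG, norm_mul, Complex.norm_real, Real.norm_of_nonneg (hb _), integral_const_mul]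
    have := mul_le_mul_of_nonneg_left (integral_norm_zonalConv_cesaro_le (m + i) hgi) (hb (m + i))
    linarith
  have hGs : Summable fun i => ∫ x, ‖G i x‖ ∂(nu n) :=
    Summable.of_nonneg_of_le (fun i => integral_nonneg fun _ => norm_nonneg _) hGn
      (hs.mul_right _)
  have hae := ae_summable_of_summable_integral_norm hGi hGs
  set F : CSphere n → ℂ := fun x => ∑' i, G i x with hF
  have hpart : ∀ N, eLpNorm (∑ i ∈ Finset.range N, G i) p (nu n) ≤
      ENNReal.ofReal (∑' i, ((2 * n - 1 + (m + i)).choose (2 * n - 1) : ℝ) * b (m + i)) *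
        eLpNorm g p (nu n) := by
    intro N
    have hnn : ∀ i, 0 ≤ ((2 * n - 1 + (m + i)).choose (2 * n - 1) : ℝ) * b (m + i) := fun i =>
      mul_nonneg (Nat.cast_nonneg _) (hb _)
    calc eLpNorm (∑ i ∈ Finset.range N, G i) p (nu n)
        ≤ ∑ i ∈ Finset.range N, eLpNorm (G i) p (nu n) :=
          eLpNorm_sum_le (fun i _ => (hGi i).aestronglyMeasurable) hp
      _ ≤ ∑ i ∈ Finset.range N, ENNReal.ofReal
            (((2 * n - 1 + (m + i)).choose (2 * n - 1) : ℝ) * b (m + i)) * eLpNorm g p (nu n) := by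
          refine Finset.sum_le_sum fun i _ => ?_
          have h1 : G i = (b (m + i) : ℂ) • zonalConv (cesaro n (m + i)) g := rfl
          rw [h1, eLpNorm_const_smul, ENNReal.ofReal_mul (Nat.cast_nonneg _),
            ENNReal.ofReal_natCast, mul_comm _ (ENNReal.ofReal _), mul_assoc]
          refine mul_le_mul' (le_of_eq ?_)
            (eLpNorm_zonalConv_cesaro_le _ hp hg.aestronglyMeasurable)
          rw [← ofReal_norm, Complex.norm_real, Real.norm_of_nonneg (hb _)]
      _ = ENNReal.ofReal (∑ i ∈ Finset.range N,
            ((2 * n - 1 + (m + i)).choose (2 * n - 1) : ℝ) * b (m + i)) * eLpNorm g p (nu n) := by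
          rw [← Finset.sum_mul, ENNReal.ofReal_sum_of_nonneg fun i _ => hnn i]
      _ ≤ _ := by
          gcongr
          exact hs.sum_le_tsum _ fun i _ => hnn i
  have hlim : ∀ᵐ x ∂(nu n), Filter.Tendsto (fun N => (∑ i ∈ Finset.range N, G i) x) Filter.atTop
      (nhds (F x)) := by
    filter_upwards [hae] with x hx
    simpa only [Finset.sum_apply] using hx.hasSum.tendsto_sum_nat
  have hmeas : ∀ N, AEStronglyMeasurable (∑ i ∈ Finset.range N, G i) (nu n) := fun N =>
    Finset.aestronglyMeasurable_sum _ fun i _ => (hGi i).aestronglyMeasurable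
  have hFn : eLpNorm F p (nu n) ≤
      ENNReal.ofReal (∑' i, ((2 * n - 1 + (m + i)).choose (2 * n - 1) : ℝ) * b (m + i)) *
        eLpNorm g p (nu n) := by
    -- Fatou's lemma carries the uniform bound on partial sums to the limit.
    refine (Lp.eLpNorm_lim_le_liminf_eLpNorm hmeas F hlim).trans ?_
    refine (Filter.liminf_le_liminf (Filter.Eventually.of_forall hpart)).trans ?_
    simp
  have hFm : MemLp F p (nu n) :=
    ⟨aestronglyMeasurable_of_tendsto_ae _ hmeas hlim,
      hFn.trans_lt (ENNReal.mul_lt_top ENNReal.ofReal_lt_top hg.2)⟩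
  refine ⟨F, hFm, hFn, fun j x => ?_⟩
  obtain ⟨C, hC0, hC⟩ := exists_zonalFun_bound (n := n) (zonal n j)
  have h1 := hasSum_integral_of_summable_integral_norm (μ := nu n)
    (F := fun i y => zonalFun (zonal n j) x y * G i y)
    (fun i => integrable_zonalFun_mul _ (hGi i) x) (by
      refine Summable.of_nonneg_of_le (fun i => integral_nonneg fun _ => norm_nonneg _)
        (fun i => ?_) (hGs.mul_left C)
      rw [← integral_const_mul]
      refine integral_mono (integrable_zonalFun_mul _ (hGi i) x).norm ((hGi i).norm.const_mul C)
        fun y => ?_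
      simp only [norm_mul]
      exact mul_le_mul_of_nonneg_right (hC x y) (norm_nonneg _))
  simp only [tsum_mul_left] at h1
  refine Eq.mpr (congrArg (HasSum · _) (funext fun i => ?_)) h1
  have h2 : ∫ y, zonalFun (zonal n j) x y * G i y ∂(nu n) =
      (b (m + i) : ℂ) * zonalConv (zonal n j) (zonalConv (cesaro n (m + i)) g) x := by
    simp only [hG, mul_left_comm _ (b (m + i) : ℂ), integral_const_mul]
    rfl
  rw [h2, zonalConv_zonal_zonalConv_cesaro j (m + i) hgi x]
  split_ifs <;> ring

/-- The set K is {1, …, N} or {0, …, N}, so both claims are covered; the mean of f matters only when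
constants are not available. -/
theorem bestApprox_harmonicSpan_le {γ : ℝ} (hγ : 0 < γ) {p : ℝ≥0∞} (hp : 1 ≤ p)
    {f g : CSphere n → ℂ} (hf : MemLp f p (nu n)) (hg : MemLp g p (nu n))
    (hfg : IsFracDeriv γ f g) {N : ℕ} (hN : 1 ≤ N) {K : Finset ℕ} (hK : ∀ j ∈ K, j ≤ N)
    (hK' : ∀ j, 1 ≤ j → j ≤ N → j ∈ K) (h0 : 0 ∉ K → ∫ x, f x ∂(nu n) = 0) :
    bestApprox f (harmonicSpan n K) p ≤
      ENNReal.ofReal (2 ^ (2 * n - 1) * 2 ^ γ * (N : ℝ) ^ (-γ)) *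
        bestApprox g (harmonicSpan n K) p := by
  have hn := one_le_of_neZero n
  have hNpos : (0 : ℝ) < N := by exact_mod_cast hN
  have hcpos : 0 < 2 ^ (2 * n - 1) * 2 ^ γ * (N : ℝ) ^ (-γ) := by positivity
  obtain ⟨a, ha, hasum, hatail⟩ := exists_cesaro_weights n hn hγ (2 * n - 1)
  obtain ⟨hs, hsle⟩ := hatail N hN
  have key : ∀ t ∈ harmonicSpan n K, bestApprox f (harmonicSpan n K) p ≤
      ENNReal.ofReal (2 ^ (2 * n - 1) * 2 ^ γ * (N : ℝ) ^ (-γ)) *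
        eLpNorm (g - t) p (nu n) := by
    intro t ht
    obtain ⟨htc, htj⟩ := continuous_of_mem_harmonicSpan ht
    have hti : Integrable t (nu n) := integrable_of_continuous htc
    have htm : MemLp t p (nu n) := htc.memLp_of_hasCompactSupport
      (HasCompactSupport.of_compactSpace t)
    have hgi : Integrable g (nu n) := hg.integrable hp
    have hfi : Integrable f (nu n) := hf.integrable hp
    obtain ⟨F, hFm, hFn, hFj⟩ := exists_cesaro_series ha (N + 1) hs hp (hg.sub htm)
    have hFi : Integrable F (nu n) := hFm.integrable hp
    have hhi : Integrable (f - F) (nu n) := hfi.sub hFi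
    have hgt : ∀ j, j ∉ K → ∀ x, zonalConv (zonal n j) (g - t) x = zonalConv (zonal n j) g x := by
      intro j hj x
      rw [zonalConv_sub _ hgi hti, htj j hj x, sub_zero]
    have hhigh : ∀ j, N < j → ∀ x, zonalConv (zonal n j) (f - F) x = 0 := by
      intro j hj x
      have h1 := hFj j x
      rw [hgt j (fun h => absurd (hK j h) (by omega)) x] at h1
      -- As j ≥ N + 1, dropping the vanishing terms with kernel degree below j leaves exactly the
      -- expansion of θ_j^{-γ/2}.
      have h2 : HasSum (fun i => if j ≤ N + 1 + i then
          ((2 * n - 1 + (N + 1 + i - j)).choose (2 * n - 1) : ℂ) * (a (N + 1 + i) : ℂ) else 0)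
          ((theta n j ^ (-(γ / 2)) : ℝ) : ℂ) := by
        have h3 := Complex.hasSum_ofReal.2 (hasum j (by omega))
        have hinj : Function.Injective fun i : ℕ => i + (j - (N + 1)) := add_left_injective _
        rw [← hinj.hasSum_iff]
        · convert h3 using 1
          funext i
          have e1 : N + 1 + (i + (j - (N + 1))) = j + i := by omega
          simp [Function.comp_apply, e1]
        · intro i hi
          rw [if_neg]
          intro h
          exact hi ⟨N + 1 + i - j, by simp only []; omega⟩
      have h4 := (h2.mul_right (zonalConv (zonal n j) g x)).unique h1
      -- Testing the fractional derivative against the zonal function with pole x gives the relation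
      -- between degree-j projections at x.
      have h5 := hfg.2 j (by omega) _ (zonalFun_zonal_mem_eigenspace hn j x)
      rw [fourierCoeff_zonalFun, fourierCoeff_zonalFun] at h5
      have hθ : 0 < theta n j := by
        have : (1 : ℝ) ≤ j := by exact_mod_cast (show 1 ≤ j by omega)
        have : (1 : ℝ) ≤ n := by exact_mod_cast hn
        rw [theta_eq n j hn]
        nlinarith
      rw [zonalConv_sub _ hfi hFi, ← h4, h5, ← mul_assoc, ← Complex.ofReal_mul,
        ← Real.rpow_add hθ, neg_add_cancel, Real.rpow_zero, Complex.ofReal_one, one_mul, sub_self]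
    -- Without constants in the space, g - t has mean zero, hence so does F; with f of mean zero, q
    -- has no constant term.
    have hzero : 0 ∉ K → ∀ x, zonalConv (zonal n 0) (f - F) x = 0 := by
      intro hK0 x
      have h1 := hFj 0 x
      have h2 := hfg.1 _ (zonalFun_zonal_mem_eigenspace hn 0 x)
      rw [fourierCoeff_zonalFun] at h2
      rw [hgt 0 hK0 x, h2] at h1
      simp only [mul_zero] at h1
      rw [zonalConv_sub _ hfi hFi, h1.unique hasSum_zero, sub_zero, zonalConv]
      simp only [zonalFun_zonal_zero, one_mul]
      exact h0 hK0
    have hq := ae_eq_sum_zonalConv hhi N hhigh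
    set q := ∑ j ∈ Finset.range (N + 1), zonalConv (zonal n j) (f - F) with hqdef
    have hqmem : q ∈ harmonicSpan n K := by
      refine Submodule.sum_mem _ fun j hj => ?_
      by_cases hjK : j ∈ K
      · exact (le_iSup₂_of_le (f := fun k (_ : k ∈ K) => eigenspace n k) j hjK le_rfl)
          (zonalConv_zonal_mem j hhi)
      · have hj0 : j = 0 := by
          by_contra hne
          exact hjK (hK' j (by omega) (by simpa [Nat.lt_succ_iff] using hj))
        subst hj0
        have : zonalConv (zonal n 0) (f - F) = 0 := funext (hzero hjK)
        rw [this]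
        exact Submodule.zero_mem _
    have hfq : f - q =ᵐ[nu n] F := by
      filter_upwards [hq] with x hx
      simp only [Pi.sub_apply] at hx ⊢
      rw [← hx]
      ring
    calc bestApprox f (harmonicSpan n K) p ≤ eLpNorm (f - q) p (nu n) := iInf₂_le q hqmem
      _ = eLpNorm F p (nu n) := eLpNorm_congr_ae hfq
      _ ≤ _ := hFn.trans (mul_le_mul_left (ENNReal.ofReal_le_ofReal hsle) _)
  have hc0 : ENNReal.ofReal (2 ^ (2 * n - 1) * 2 ^ γ * (N : ℝ) ^ (-γ)) ≠ 0 := by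
    simpa using hcpos
  unfold bestApprox at key ⊢
  -- The factor is nonzero and finite, so it moves inside the infimum and the bound for each t
  -- suffices.
  simp only [ENNReal.mul_iInf_of_ne hc0 ENNReal.ofReal_ne_top]
  exact le_iInf₂ key

end Favard

end ComplexSphere

open ComplexSphere in
theorem theorem1 (n : ℕ) (hn : 1 ≤ n) (γ : ℝ) (hγ : ((realDim n : ℝ) - 1) / 2 < γ) :
    ∃ C : ℝ, 0 < C ∧
      ∀ (p : ℝ≥0∞), 1 ≤ p →
      ∀ (f g : CSphere n → ℂ), MemLp f p (nu n) → MemLp g p (nu n) → IsFracDeriv γ f g →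
      ∀ N : ℕ, 1 ≤ N →
        ((∫ x, f x ∂(nu n) = 0) →
          bestApprox f (polySpace n N) p ≤
            ENNReal.ofReal (C * (N : ℝ) ^ (-γ)) * bestApprox g (polySpace n N) p) ∧
        bestApprox f (polySpaceConst n N) p ≤
          ENNReal.ofReal (C * (N : ℝ) ^ (-γ)) * bestApprox g (polySpaceConst n N) p := by
  have : NeZero n := ⟨by omega⟩
  have hγ0 : 0 < γ := by
    have h1 : (1 : ℝ) ≤ (realDim n : ℝ) := by
      exact_mod_cast (show 1 ≤ realDim n by unfold realDim; omega)
    linarith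
  refine ⟨2 ^ (2 * n - 1) * 2 ^ γ, by positivity, fun p hp f g hf hg hfg N hN => ⟨fun h0 => ?_, ?_⟩⟩
  · exact bestApprox_harmonicSpan_le hγ0 hp hf hg hfg hN (fun j hj => (Finset.mem_Icc.1 hj).2)
      (fun j h1 h2 => Finset.mem_Icc.2 ⟨h1, h2⟩) fun _ => h0
  · exact bestApprox_harmonicSpan_le hγ0 hp hf hg hfg hN (fun j hj => (Finset.mem_Icc.1 hj).2)
      (fun j _ h2 => Finset.mem_Icc.2 ⟨Nat.zero_le j, h2⟩) fun h => absurd (by simp) h
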